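/- A Lusin space is a topological space homeomorphic to a Borel subset of a Polish space. For a Lusin space $X$, let $\mathcal P(X)$ be the space of Borel probability measures on $X$ with the weak topology (testing against bounded continuous functions), and let $D(X)$ be the space of càdlàg functions $[0,1]\to X$ (right-continuous with left limits in $X$) with the Meyer–Zheng topology, i.e. the topology of convergence in measure with respect to $\lambda=\frac12(\mathrm{Leb}+\delta_1)$ on $[0,1]$. The intensity $I(P)\in\mathcal P(X)$ of $P\in\mathcal P(\mathcal P(X))$ is defined by $I(P)(B)=\int q(B)\,P(dq)$ for Borel $B\subseteq X$. Let $S$ be a Lusin space, and let $Z=(Z_t)_{t\in[0,1]}$ be the canonical process on $D(\mathcal P(S))$, with generated filtration $\mathcal F_t=\sigma(Z_s: s\le t)$. Let $\mathcal M(S)\subseteq\mathcal P(D(\mathcal P(S)))$ be the set, with the subspace topology, of all laws $\mu$ under which $Z$ is a measure-valued martingale in its own filtration: for all $s\le t$ and all bounded Borel $f:S\to\mathbb R$, $\mathbb E_\mu[\int f\,dZ_t\mid\mathcal F_s]=\int f\,dZ_s$ $\mu$-almost surely. For $\mu\in\mathcal P(D(\mathcal P(S)))$ put $\Phi(\mu)=I(\mathcal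 L_\mu(Z_1))\in\mathcal P(S)$, where $\mathcal L_\mu(Z_1)$ is the law of $Z_1$ under $\mu$. **Theorem.** (a) A set $\mathcal A\subseteq\mathcal M(S)$ is relatively compact in $\mathcal P(D(\mathcal P(S)))$ (that is, has compact closure there) if and only if $\Phi(\mathcal A)=\{\Phi(\mu):\mu\in\mathcal A\}$ is relatively compact in $\mathcal P(S)$. (b) $\mathcal M(S)$ is a Lusin space; if $S$ is Polish, then $\mathcal M(S)$ is Polish; if $S$ is compact and metrizable, then $\mathcal M(S)$ is compact and metrizable. -/

import Mathlib

open MeasureTheory Set Filter Topology TopologicalSpace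
open scoped ENNReal unitInterval

universe u

/-! ### Lusin spaces -/

/-- A topological space is a *Lusin space* if it is homeomorphic to a Borel subset of a
Polish space. -/
class LusinSpace (S : Type u) [TopologicalSpace S] : Prop where
  exists_embedding : ∃ (S' : Type u) (_ : TopologicalSpace S') (_ : PolishSpace S') (ι : S → S'),
    IsEmbedding ι ∧ MeasurableSet[borel S'] (range ι)

instance (priority := 100) LusinSpace.metrizableSpace (S : Type u) [TopologicalSpace S]
    [LusinSpace S] : MetrizableSpace S := by
  obtain ⟨S', _, _, ι, hι, -⟩ := LusinSpace.exists_embedding (S := S)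
  exact hι.metrizableSpace

instance (priority := 100) LusinSpace.secondCountableTopology (S : Type u) [TopologicalSpace S]
    [LusinSpace S] : SecondCountableTopology S := by
  obtain ⟨S', _, _, ι, hι, -⟩ := LusinSpace.exists_embedding (S := S)
  exact hι.secondCountableTopology

instance (priority := 100) PolishSpace.lusinSpace (S : Type u) [TopologicalSpace S]
    [PolishSpace S] : LusinSpace S :=
  ⟨S, inferInstance, inferInstance, id, IsEmbedding.id, by
    rw [range_id]; exact @MeasurableSet.univ S (borel S)⟩

/-! ### Càdlàg paths and the Meyer–Zheng topology -/

/-- The measure `λ = (Leb + δ₁) / 2` on `[0,1]`. -/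
noncomputable def mzMeasure : Measure I :=
  (2⁻¹ : ℝ≥0∞) • ((volume : Measure I) + Measure.dirac 1)

/-- The space `D(X)` of càdlàg functions `[0,1] → X`: right continuous with left limits. -/
structure CadlagPath (X : Type*) [TopologicalSpace X] where
  toFun : I → X
  rightCont : ∀ t, ContinuousWithinAt toFun (Ici t) t
  leftLim : ∀ t, ∃ l, Tendsto toFun (𝓝[<] t) (𝓝 l)

namespace CadlagPath

instance (X : Type*) [TopologicalSpace X] : CoeFun (CadlagPath X) (fun _ => I → X) := ⟨toFun⟩

/-- For a metric space `X`, the Ky Fan (pseudo)metric on `D(X)`: the distance of `f` and `g` is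
the infimum of all `ε` such that `λ {t | d (f t) (g t) > ε} ≤ ε`. It metrizes convergence in
measure with respect to `λ`. -/
@[reducible] noncomputable def kyFan (X : Type*) [PseudoEMetricSpace X] :
    PseudoEMetricSpace (CadlagPath X) where
  edist f g := sInf {ε : ℝ≥0∞ | mzMeasure {t | ε < edist (f t) (g t)} ≤ ε}
  edist_self f := by
    refine le_antisymm (sInf_le ?_) bot_le
    simp
  edist_comm f g := by simp only [edist_comm]
  edist_triangle f g h := by
    rw [ENNReal.sInf_add]
    refine le_iInf₂ fun a ha => ?_
    rw [add_comm, ENNReal.sInf_add]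
    refine le_iInf₂ fun b hb => ?_
    rw [add_comm]
    refine sInf_le ?_
    have hsub : {t | a + b < edist (f t) (h t)} ⊆
        {t | a < edist (f t) (g t)} ∪ {t | b < edist (g t) (h t)} := by
      intro t ht
      by_contra hc
      simp only [mem_union, mem_ofPred_eq, not_or, not_lt] at hc ht
      exact absurd ((edist_triangle _ _ _).trans (add_le_add hc.1 hc.2)) (not_le.2 ht)
    exact (measure_mono hsub).trans ((measure_union_le _ _).trans (add_le_add ha hb))

/-- Convergence for the Ky Fan metric is convergence in measure with respect to `λ`. -/
theorem kyFan_tendsto_iff {X : Type*} [PseudoEMetricSpace X] {ι : Type*} {l : Filter ι}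
    (u : ι → CadlagPath X) (f : CadlagPath X) :
    Tendsto u l (@nhds _ (kyFan X).toUniformSpace.toTopologicalSpace f) ↔
      TendstoInMeasure mzMeasure (fun i => (u i : I → X)) l (f : I → X) := by
  let _ := kyFan X
  rw [EMetric.tendsto_nhds]
  constructor
  · intro h ε hε
    rw [ENNReal.tendsto_nhds_zero]
    intro δ hδ
    filter_upwards [h (min ε δ) (lt_min hε hδ)] with i hi
    obtain ⟨a, ha, hlt⟩ := sInf_lt_iff.1 hi
    refine (measure_mono ?_).trans (ha.trans (hlt.le.trans (min_le_right _ _)))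
    intro t ht
    exact lt_of_lt_of_le (hlt.trans_le (min_le_left _ _)) ht
  · intro h ε hε
    obtain ⟨δ, hδ0, hδ⟩ := exists_between hε
    have := ENNReal.tendsto_nhds_zero.1 (h δ hδ0) δ hδ0
    filter_upwards [this] with i hi
    refine lt_of_le_of_lt (sInf_le ?_) hδ
    refine (measure_mono ?_).trans hi
    intro t (ht : δ < _)
    exact ht.le

/-- The Meyer–Zheng topology on `D(X)`, the topology of convergence in measure with respect to
`λ`. All metrics that generate the topology of `X` lead to the same topology on `D(X)`. -/
noncomputable instance (X : Type*) [TopologicalSpace X] [MetrizableSpace X] :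
    TopologicalSpace (CadlagPath X) :=
  letI := metrizableSpaceMetric X
  (kyFan X).toUniformSpace.toTopologicalSpace

/-- `D(X)` carries the Borel `σ`-algebra of the Meyer–Zheng topology. -/
noncomputable instance (X : Type*) [TopologicalSpace X] [MetrizableSpace X] :
    MeasurableSpace (CadlagPath X) := borel _

instance (X : Type*) [TopologicalSpace X] [MetrizableSpace X] : BorelSpace (CadlagPath X) := ⟨rfl⟩

section Measurability

variable {X : Type*} [TopologicalSpace X] [MetrizableSpace X]

theorem isClosed_ae_mem (A : Set I) {K : Set X} (hK : IsClosed K) :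
    IsClosed {f : CadlagPath X | mzMeasure {s | s ∈ A ∧ f s ∉ K} = 0} := by
  let _ := metrizableSpaceMetric X
  let _ := kyFan X
  rw [← isOpen_compl_iff]
  refine EMetric.isOpen_iff.2 fun f hf => ?_
  have hU : {s | s ∈ A ∧ f s ∉ K} =
      ⋃ n : ℕ, {s | s ∈ A ∧ ((n : ℝ≥0∞) + 1)⁻¹ < Metric.infEDist (f s) K} := by
    ext s
    simp only [mem_ofPred_eq, mem_iUnion, exists_and_left, and_congr_right_iff]
    intro _
    constructor
    · intro h
      have hpos : 0 < Metric.infEDist (f s) K := by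
        rw [pos_iff_ne_zero]
        intro h0
        exact h (by rwa [← hK.closure_eq, Metric.mem_closure_iff_infEDist_zero])
      obtain ⟨n, hn⟩ := ENNReal.exists_inv_nat_lt hpos.ne'
      exact ⟨n, lt_of_le_of_lt (ENNReal.inv_le_inv.2 le_self_add) hn⟩
    · rintro ⟨n, hn⟩ hK'
      rw [Metric.infEDist_zero_of_mem hK'] at hn
      exact not_lt_bot hn
  have hne : mzMeasure {s | s ∈ A ∧ f s ∉ K} ≠ 0 := hf
  rw [hU, ne_eq, measure_iUnion_null_iff, not_forall] at hne
  obtain ⟨n, hn⟩ := hne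
  set B := {s | s ∈ A ∧ ((n : ℝ≥0∞) + 1)⁻¹ < Metric.infEDist (f s) K} with hB
  refine ⟨min ((n : ℝ≥0∞) + 1)⁻¹ (mzMeasure B), ?_, ?_⟩
  · refine lt_min ?_ (pos_iff_ne_zero.2 hn)
    simp
  · intro g hg hg0
    obtain ⟨a, ha, hlt⟩ := sInf_lt_iff.1 (Metric.mem_eball.1 hg)
    have ha' : mzMeasure {t | a < edist (g t) (f t)} ≤ a := ha
    have hg0' : mzMeasure {s | s ∈ A ∧ g s ∉ K} = 0 := hg0
    have hsub : B ⊆ {t | a < edist (g t) (f t)} ∪ {s | s ∈ A ∧ g s ∉ K} := by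
      rintro s ⟨hsA, hs⟩
      by_contra hc
      simp only [mem_union, mem_ofPred_eq, not_or, not_lt, not_and, not_not] at hc
      have h1 := Metric.infEDist_le_edist_of_mem (x := f s) (hc.2 hsA)
      rw [edist_comm] at h1
      exact absurd (hs.trans_le (h1.trans hc.1))
        (not_lt.2 (hlt.le.trans (min_le_left _ _)))
    have := (measure_mono (μ := mzMeasure) hsub).trans (measure_union_le _ _)
    rw [hg0', add_zero] at this
    exact absurd (this.trans ha') (not_le.2 (hlt.trans_le (min_le_right _ _)))

theorem mzMeasure_pos {t : I} {V : Set I} (hV : V ∈ 𝓝[≥] t) : mzMeasure V ≠ 0 := by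
  rcases eq_or_ne t 1 with rfl | ht
  · have h1 : (1 : I) ∈ V := mem_of_mem_nhdsWithin self_mem_Ici hV
    simp [mzMeasure, h1]
  · have ht1 : t < 1 := lt_of_le_of_ne t.2.2 ht
    obtain ⟨b, hb, hbV⟩ := (mem_nhdsGE_iff_exists_Ico_subset' ht1).1 hV
    intro h0
    have : mzMeasure (Ico t b) = 0 := measure_mono_null hbV h0
    simp [mzMeasure] at this
    have h2 : (t : ℝ) < b := hb
    exact absurd this.1 (not_le.2 h2)

theorem measurableSet_eval_mem (t : I) {U : Set X} (hU : IsOpen U) :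
    MeasurableSet {f : CadlagPath X | f t ∈ U} := by
  let _ := metrizableSpaceMetric X
  obtain ⟨A, hA⟩ := (𝓝[≥] t).exists_antitone_basis
  have hinf : Continuous fun x : X => Metric.infEDist x Uᶜ := Metric.continuous_infEDist
  let K : ℕ → Set X := fun m => {x | ((m : ℝ≥0∞) + 1)⁻¹ ≤ Metric.infEDist x Uᶜ}
  have hK : ∀ m, IsClosed (K m) := fun m => isClosed_le continuous_const hinf
  have key : {f : CadlagPath X | f t ∈ U} =
      ⋃ m : ℕ, ⋃ n : ℕ, {f : CadlagPath X | mzMeasure {s | s ∈ A n ∧ f s ∉ K m} = 0} := by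
    ext f
    simp only [mem_ofPred_eq, mem_iUnion]
    constructor
    · intro hf
      have hpos : Metric.infEDist (f t) Uᶜ ≠ 0 := by
        intro h0
        rw [← Metric.mem_closure_iff_infEDist_zero, hU.isClosed_compl.closure_eq] at h0
        exact h0 hf
      obtain ⟨m, hm⟩ := ENNReal.exists_inv_nat_lt hpos
      have hm' : ((m : ℝ≥0∞) + 1)⁻¹ < Metric.infEDist (f t) Uᶜ :=
        lt_of_le_of_lt (ENNReal.inv_le_inv.2 le_self_add) hm
      have hev : ∀ᶠ s in 𝓝[≥] t, ((m : ℝ≥0∞) + 1)⁻¹ < Metric.infEDist (f s) Uᶜ :=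
        (hinf.continuousAt.comp_continuousWithinAt (f.rightCont t)).eventually_const_lt hm'
      obtain ⟨n, -, hn⟩ := hA.1.mem_iff.1 hev
      refine ⟨m, n, ?_⟩
      have : {s | s ∈ A n ∧ f s ∉ K m} = ∅ := by
        ext s
        simp only [mem_ofPred_eq, mem_empty_iff_false, iff_false, not_and, not_not]
        intro hs
        have h1 : ((m : ℝ≥0∞) + 1)⁻¹ < Metric.infEDist (f s) Uᶜ := hn hs
        exact h1.le
      rw [this, measure_empty]
    · rintro ⟨m, n, h⟩
      by_contra hf
      have hfK : f t ∈ (K m)ᶜ := by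
        intro (hk : ((m : ℝ≥0∞) + 1)⁻¹ ≤ _)
        rw [Metric.infEDist_zero_of_mem (show f t ∈ Uᶜ from hf)] at hk
        simp at hk
      have hev : (f : I → X) ⁻¹' (K m)ᶜ ∈ 𝓝[≥] t :=
        (f.rightCont t).preimage_mem_nhdsWithin ((hK m).isOpen_compl.mem_nhds hfK)
      exact mzMeasure_pos (inter_mem (hA.1.mem_of_mem trivial) hev) h
  rw [key]
  exact .iUnion fun m => .iUnion fun n => (isClosed_ae_mem (A n) (hK m)).measurableSet

end Measurability

end CadlagPath

/-! ### Measure-valued martingales -/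

/-- The intensity operator `I : P(P(S)) → P(S)`, `I(P)(B) = ∫ q(B) P(dq)`. -/
noncomputable def intensity {S : Type u} [MeasurableSpace S]
    (P : ProbabilityMeasure (ProbabilityMeasure S)) : ProbabilityMeasure S :=
  ⟨(P : Measure (ProbabilityMeasure S)).bind fun q => (q : Measure S),
    isProbabilityMeasure_bind measurable_subtype_coe.aemeasurable
      (.of_forall fun q => inferInstanceAs (IsProbabilityMeasure (q : Measure S)))⟩

theorem lintegral_intensity {S : Type u} [MeasurableSpace S]
    (P : ProbabilityMeasure (ProbabilityMeasure S)) {f : S → ℝ≥0∞} (hf : Measurable f) :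
    ∫⁻ s, f s ∂(intensity P : Measure S) =
      ∫⁻ q, ∫⁻ s, f s ∂(q : Measure S) ∂(P : Measure (ProbabilityMeasure S)) :=
  Measure.lintegral_bind measurable_subtype_coe.aemeasurable hf.aemeasurable

section MeasureValued

variable {S : Type u} [TopologicalSpace S] [MeasurableSpace S] [BorelSpace S]

/-- A map into `P(S)` is measurable as soon as preimages of weakly open sets are measurable. -/
theorem measurable_probabilityMeasure_of_isOpen [PseudoMetrizableSpace S]
    {Ω : Type*} [MeasurableSpace Ω] {Z : Ω → ProbabilityMeasure S}
    (h : ∀ U, IsOpen U → MeasurableSet (Z ⁻¹' U)) : Measurable Z := by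
  let _ := pseudoMetrizableSpacePseudoMetric S
  have hcont : ∀ {φ : ProbabilityMeasure S → ℝ≥0∞}, Continuous φ → Measurable fun ω => φ (Z ω) :=
    fun {φ} hφ => measurable_of_isOpen fun U hU => h _ (hU.preimage hφ)
  refine Measurable.subtype_mk (f := fun ω => (Z ω : Measure S)) ?_
  refine Measurable.measure_of_isPiSystem_of_isProbabilityMeasure
    (borel_eq_generateFrom_isClosed (α := S) ▸ BorelSpace.measurable_eq) isPiSystem_isClosed ?_
  intro F hF
  have hF' : IsClosed F := hF
  refine measurable_of_tendsto_metrizable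
    (f := fun n ω => ∫⁻ x, hF'.apprSeq n x ∂(Z ω : Measure S)) (fun n => ?_) ?_
  · exact hcont (ProbabilityMeasure.continuous_lintegral_boundedContinuousFunction _)
  · rw [tendsto_pi_nhds]
    intro ω
    exact HasOuterApproxClosed.tendsto_lintegral_apprSeq hF' _

/-- `W = E[Z | m]` for random probability measures `Z`, `W` on `(Ω, P)`: `W` is `m`-measurable and
`∫ f dW = E[∫ f dZ | m]` almost surely for all bounded Borel functions `f : S → ℝ`. -/
def IsMeasureCondExp {Ω : Type*} (m : MeasurableSpace Ω) {_ : MeasurableSpace Ω} (P : Measure Ω)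
    (Z W : Ω → ProbabilityMeasure S) : Prop :=
  Measurable[m] W ∧ ∀ f : S → ℝ, Measurable f → (∃ C, ∀ x, |f x| ≤ C) →
    P[fun ω => ∫ x, f x ∂(Z ω : Measure S) | m] =ᵐ[P] fun ω => ∫ x, f x ∂(W ω : Measure S)

/-- A measure-valued martingale: `E[Z t | ℱ s] = Z s` for all `s ≤ t`. -/
def IsMeasureMartingale {Ω : Type*} {m₀ : MeasurableSpace Ω} (ℱ : Filtration I m₀) (P : Measure Ω)
    (Z : I → Ω → ProbabilityMeasure S) : Prop :=
  ∀ s t, s ≤ t → IsMeasureCondExp (ℱ s) P (Z t) (Z s)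

variable (S) [LusinSpace S]

/-- The canonical process on `D(P(S))`. -/
def canonicalProcess (t : I) (f : CadlagPath (ProbabilityMeasure S)) : ProbabilityMeasure S := f t

theorem measurable_canonicalProcess (t : I) : Measurable (canonicalProcess S t) :=
  measurable_probabilityMeasure_of_isOpen fun _ hU => CadlagPath.measurableSet_eval_mem t hU

/-- The filtration on `D(P(S))` generated by the canonical process. -/
def canonicalFiltration :
    Filtration I (inferInstance : MeasurableSpace (CadlagPath (ProbabilityMeasure S))) where
  seq t := ⨆ s ≤ t, MeasurableSpace.comap (canonicalProcess S s) inferInstance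
  mono' _ _ h := biSup_mono fun _ hs => hs.trans h
  le' _ := iSup₂_le fun s _ => (measurable_canonicalProcess S s).comap_le

/-- The set `M(S) ⊆ P(D(P(S)))` of all laws under which the canonical process is a measure-valued
martingale in its own filtration. -/
def martingaleLaws : Set (ProbabilityMeasure (CadlagPath (ProbabilityMeasure S))) :=
  {μ | IsMeasureMartingale (canonicalFiltration S)
    (μ : Measure (CadlagPath (ProbabilityMeasure S))) (canonicalProcess S)}

variable {S}

/-- `Φ(μ) = I(e₁#μ)`, the intensity of the law of the terminal value `Z₁`. -/
noncomputable def terminalIntensity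
    (μ : ProbabilityMeasure (CadlagPath (ProbabilityMeasure S))) : ProbabilityMeasure S :=
  intensity (μ.map (measurable_canonicalProcess S 1).aemeasurable)

end MeasureValued

/-! The core is that M(S) is compact for compact `S`. The general case follows by embedding `S` into
the Hilbert cube.

Compact case. The space X = P(S) is compact and metrizable, and integrals of a dense sequence of
test functions give continuous maps φ_k : X → [0,1] that separate points. Over the countable set of
dyadic times, the laws on the product of copies of X that make every φ_k a martingale are cut out by
equations between integrals of continuous functions, so they form a compact set
(`isCompact_cylinderLaws`). By Doob's upcrossing inequality almost every sample has one-sided limits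
and hence a càdlàg regularization. Regularization is not continuous in the sample. However,
orthogonality of martingale increments bounds the expected λ-mean square error between φ_k of the
regularized path and φ_k of its level m step approximation by 2^(-m), uniformly over these laws
(`lintegral_sq_regularize_sub_le`). The step approximation is continuous in the dyadic values, so
the law of the regularization depends continuously on the original law
(`continuousOn_regularizedLaw`), and M(S) is a continuous image of a compact set.

General case. Let `S` be embedded in the cube Y with Borel image. A martingale law over Y comes from
one over `S` as soon as its terminal intensity does not charge Y \ S (`mem_range_lawPush`). Indeed,
inner regularity gives closed sets K_n ⊆ S of nearly full intensity, and Doob's maximal inequality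
for the mass of the complement of K_n shows that almost surely this mass becomes small for suitable
n, uniformly in time. Hence neither the values nor the left limits of the path leave P(S). The map Φ
is continuous because λ has an atom at 1. So M(S) sits in the compact space M(Y) as the set where
Φ(μ) vanishes on Y \ S, which is Borel, and a G_δ when `S` is Polish. The laws whose Φ lies in a
given compact subset of P(S) form a closed subset of M(Y), which gives the compactness criterion. -/

/-! ### Polish and Lusin spaces inside the Hilbert cube -/

/-- A completely metrizable subspace of a metrizable space is a `G_δ`. -/
theorem Topology.IsEmbedding.exists_range_eq_iInter {X Y : Type*} [TopologicalSpace X]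
    [PolishSpace X] [TopologicalSpace Y] [MetrizableSpace Y] {ι : X → Y} (hι : IsEmbedding ι) :
    ∃ U : ℕ → Set Y, (∀ n, IsOpen (U n)) ∧ range ι = ⋂ n, U n := by
  let _ := metrizableSpaceMetric Y
  let _ := TopologicalSpace.upgradeIsCompletelyMetrizable X
  obtain ⟨C, hCo, hC⟩ := (isClosed_closure (s := range ι)).isGδ.eq_iInter_nat
  -- `V n` collects the open sets whose trace on `X` has small diameter. At a point of the closure
  -- lying in every `V n`, the trace of the neighbourhood filter is Cauchy, and completeness of `X`
  -- supplies a preimage.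
  let V : ℕ → Set Y := fun n =>
    ⋃₀ {V | IsOpen V ∧ ∀ x ∈ ι ⁻¹' V, ∀ x' ∈ ι ⁻¹' V, dist x x' < 1 / ((n : ℝ) + 1)}
  refine ⟨fun n => C n ∩ V n, fun n => (hCo n).inter (isOpen_sUnion fun _ h => h.1), ?_⟩
  rw [iInter_inter_distrib, ← hC]
  refine Subset.antisymm ?_ ?_
  · rintro _ ⟨x, rfl⟩
    refine ⟨subset_closure (mem_range_self x), mem_iInter.2 fun n => ?_⟩
    have hpos : (0 : ℝ) < 1 / ((n : ℝ) + 1) / 2 := by positivity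
    obtain ⟨W, hW, hWx⟩ := hι.isInducing.isOpen_iff.1
      (Metric.isOpen_ball (x := x) (ε := 1 / ((n : ℝ) + 1) / 2))
    refine ⟨W, ⟨hW, fun a ha b hb => ?_⟩, ?_⟩
    · rw [hWx] at ha hb
      calc dist a b ≤ dist a x + dist b x := dist_triangle_right _ _ _
        _ < 1 / ((n : ℝ) + 1) / 2 + 1 / ((n : ℝ) + 1) / 2 := add_lt_add ha hb
        _ = _ := by ring
    · have : x ∈ ι ⁻¹' W := hWx ▸ Metric.mem_ball_self hpos
      exact this
  · rintro y ⟨hyC, hyV⟩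
    have hne : (comap ι (𝓝 y)).NeBot := by
      rw [comap_neBot_iff_frequently]
      exact mem_closure_iff_frequently.1 hyC
    have hcau : Cauchy (comap ι (𝓝 y)) := by
      refine Metric.cauchy_iff.2 ⟨hne, fun ε hε => ?_⟩
      obtain ⟨n, hn⟩ := exists_nat_one_div_lt hε
      obtain ⟨W, ⟨hW, hWd⟩, hyW⟩ := mem_iInter.1 hyV n
      exact ⟨ι ⁻¹' W, preimage_mem_comap (hW.mem_nhds hyW),
        fun a ha b hb => (hWd a ha b hb).trans hn⟩
    obtain ⟨x, hx⟩ := CompleteSpace.complete hcau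
    have h1 : Tendsto ι (comap ι (𝓝 y)) (𝓝 (ι x)) := (hι.continuous.tendsto x).mono_left hx
    exact ⟨x, tendsto_nhds_unique h1 tendsto_comap⟩

/-- A countable intersection of open sets in a Polish space is Polish. -/
theorem polishSpace_iInter_of_isOpen {Y : Type*} [TopologicalSpace Y] [PolishSpace Y]
    {U : ℕ → Set Y} (hU : ∀ n, IsOpen (U n)) : PolishSpace (⋂ n, U n : Set Y) := by
  have := fun n => (hU n).polishSpace
  -- The intersection is the diagonal of the product of the Polish spaces `U n`, and the diagonal is
  -- closed.
  let F : (⋂ n, U n : Set Y) → (n : ℕ) → U n := fun y n => ⟨y, mem_iInter.1 y.2 n⟩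
  have hF : Continuous F := continuous_pi fun n => continuous_subtype_val.subtype_mk _
  have hemb : IsEmbedding F := by
    refine IsEmbedding.of_comp hF (g := fun z => ((z 0 : U 0) : Y)) (by fun_prop) ?_
    exact IsEmbedding.subtypeVal
  have hrange : range F = ⋂ n, {z | ((z n : U n) : Y) = (z 0 : U 0)} := by
    ext z
    simp only [mem_range, mem_iInter, mem_ofPred_eq]
    constructor
    · rintro ⟨y, rfl⟩ n
      rfl
    · intro h
      exact ⟨⟨z 0, mem_iInter.2 fun n => h n ▸ (z n).2⟩, funext fun n => Subtype.ext (h n).symm⟩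
  refine IsClosedEmbedding.polishSpace ⟨hemb, ?_⟩
  rw [hrange]
  exact isClosed_iInter fun n => isClosed_eq (by fun_prop) (by fun_prop)

/-- A Lusin space embeds into the Hilbert cube with Borel image. -/
theorem LusinSpace.exists_embedding_hilbertCube (S : Type u) [TopologicalSpace S] [LusinSpace S] :
    ∃ ι : S → ℕ → I, IsEmbedding ι ∧ MeasurableSet (range ι) := by
  obtain ⟨S', _, _, ι, hι, hm⟩ := LusinSpace.exists_embedding (S := S)
  let _ := metrizableSpaceMetric S'
  let _ : MeasurableSpace S' := borel S'
  have : BorelSpace S' := ⟨rfl⟩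
  obtain ⟨F, hF⟩ := Metric.PiNatEmbed.exists_embedding_to_hilbert_cube (X := S')
  refine ⟨F ∘ ι, hF.comp hι, ?_⟩
  rw [range_comp]
  -- Lusin–Souslin: an injective continuous image of a Borel set is Borel.
  exact hm.image_of_continuousOn_injOn hF.continuous.continuousOn hF.injective.injOn

/-! ### Embeddings of spaces of probability measures -/

section Map

variable {X Y : Type*} [TopologicalSpace X] [MeasurableSpace X] [BorelSpace X]
  [TopologicalSpace Y] [MeasurableSpace Y] [BorelSpace Y]

/-- Push-forward of probability measures under a continuous map. -/
noncomputable def MeasureTheory.ProbabilityMeasure.push {ι : X → Y} (hι : Continuous ι)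
    (ν : ProbabilityMeasure X) : ProbabilityMeasure Y :=
  ν.map hι.aemeasurable

theorem MeasureTheory.ProbabilityMeasure.push_apply {ι : X → Y} (hι : Continuous ι)
    (ν : ProbabilityMeasure X) {B : Set Y} (hB : MeasurableSet B) :
    (ν.push hι : Measure Y) B = (ν : Measure X) (ι ⁻¹' B) :=
  Measure.map_apply hι.measurable hB

theorem MeasureTheory.ProbabilityMeasure.continuous_push {ι : X → Y} (hι : Continuous ι) :
    Continuous (ProbabilityMeasure.push hι) :=
  ProbabilityMeasure.continuous_map hι

omit [TopologicalSpace X] [BorelSpace X] [TopologicalSpace Y] [BorelSpace Y] in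
theorem MeasureTheory.Measure.map_injective_of_comap_eq {ι : X → Y}
    (h : MeasurableSpace.comap ι ‹MeasurableSpace Y› = ‹MeasurableSpace X›)
    {μ ν : Measure X} (hμν : μ.map ι = ν.map ι) : μ = ν := by
  have hm : Measurable ι := measurable_iff_comap_le.2 h.le
  ext A hA
  rw [← h] at hA
  obtain ⟨B, hB, rfl⟩ := hA
  rw [← Measure.map_apply hm hB, hμν, Measure.map_apply hm hB]

/-- By the portmanteau theorem, weak convergence is lower semicontinuity of the masses of open sets.
Each open set of `X` is the trace of an open set of `Y` with the same mass under the push-forward.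
-/
theorem MeasureTheory.ProbabilityMeasure.isEmbedding_push [MetrizableSpace X] [MetrizableSpace Y]
    [SecondCountableTopology Y] {ι : X → Y} (hι : IsEmbedding ι) :
    IsEmbedding (ProbabilityMeasure.push hι.continuous) := by
  have hinj : Function.Injective (ProbabilityMeasure.push hι.continuous) := by
    intro μ ν h
    refine Subtype.ext (Measure.map_injective_of_comap_eq (ι := ι) ?_ (congrArg Subtype.val h))
    rw [‹BorelSpace X›.measurable_eq, ‹BorelSpace Y›.measurable_eq, hι.eq_induced, borel_comap]
  refine ⟨isInducing_iff_nhds.2 fun ν => le_antisymm ?_ ?_, hinj⟩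
  · exact (ProbabilityMeasure.continuous_push hι.continuous).continuousAt.le_comap
  · let _ := metrizableSpaceMetric X
    refine tendsto_of_forall_isOpen_le_liminf' (μs := id)
      (L := comap (ProbabilityMeasure.push hι.continuous) (𝓝 (ν.push hι.continuous))) fun G hG => ?_
    obtain ⟨V, hV, rfl⟩ := hι.isInducing.isOpen_iff.1 hG
    have h := ProbabilityMeasure.le_liminf_measure_open_of_tendsto
      (tendsto_comap (f := ProbabilityMeasure.push hι.continuous)
        (x := 𝓝 (ν.push hι.continuous))) hV
    simpa only [ProbabilityMeasure.push_apply _ _ hV.measurableSet, id] using h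

omit [TopologicalSpace X] [BorelSpace X] [TopologicalSpace Y] [BorelSpace Y] in
/-- A probability measure that is concentrated on a measurable subset of the range of `ι` is a
push-forward under `ι`. -/
theorem MeasureTheory.ProbabilityMeasure.exists_map_eq {ι : X → Y} (hinj : Function.Injective ι)
    (h : MeasurableSpace.comap ι ‹MeasurableSpace Y› = ‹MeasurableSpace X›)
    (μ : ProbabilityMeasure Y) {G : Set Y} (hGι : G ⊆ range ι)
    (hμ : (μ : Measure Y) Gᶜ = 0) :
    ∃ ν : ProbabilityMeasure X, (ν : Measure X).map ι = μ := by
  have hm : Measurable ι := measurable_iff_comap_le.2 h.le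
  -- The range need not be measurable. Being conull, it is null-measurable, which suffices for
  -- `Measure.comap`.
  have hae : (range ι : Set Y) =ᵐ[(μ : Measure Y)] univ :=
    eventuallyEq_univ.2 (mem_of_superset (mem_ae_iff.2 hμ) hGι)
  have hnull : ∀ A, MeasurableSet A → NullMeasurableSet (ι '' A) (μ : Measure Y) := by
    intro A hA
    rw [← h] at hA
    obtain ⟨B, hB, rfl⟩ := hA
    rw [image_preimage_eq_inter_range]
    exact hB.nullMeasurableSet.inter (nullMeasurableSet_univ.congr hae.symm)
  have hmap : ((μ : Measure Y).comap ι).map ι = μ := by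
    ext B hB
    rw [Measure.map_apply hm hB, Measure.comap_apply₀ _ _ hinj hnull (hm hB).nullMeasurableSet,
      image_preimage_eq_inter_range]
    simpa using measure_congr ((ae_eq_refl B).inter hae)
  refine ⟨⟨(μ : Measure Y).comap ι, ⟨?_⟩⟩, hmap⟩
  have := congrArg (fun m : Measure Y => m univ) hmap
  simpa [Measure.map_apply hm MeasurableSet.univ] using this

end Map

/-! ### Test functions on compact metrizable spaces -/

section TestFunctions

variable (X : Type*) [TopologicalSpace X] [CompactSpace X] [MetrizableSpace X]

/-- A dense sequence of continuous functions `X → [0,1]`. -/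
noncomputable def testFun (k : ℕ) : C(X, I) :=
  denseSeq C(X, I) k

variable {X}
variable [MeasurableSpace X] [BorelSpace X]

theorem MeasureTheory.Measure.ext_of_integral_testFun {μ ν : Measure X} [IsFiniteMeasure μ]
    [IsFiniteMeasure ν] (h : ∀ k, ∫ x, (testFun X k x : ℝ) ∂μ = ∫ x, (testFun X k x : ℝ) ∂ν) :
    μ = ν := by
  have hcont : ∀ (ρ : Measure X) [IsFiniteMeasure ρ],
      Continuous fun f : C(X, I) => ∫ x, (f x : ℝ) ∂ρ := by
    intro ρ _
    refine continuous_of_dominated (bound := fun _ => 1) (fun f => ?_) (fun f => ?_)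
      (integrable_const _) (.of_forall fun x => by fun_prop)
    · exact (by fun_prop : Continuous fun x => (f x : ℝ)).aestronglyMeasurable
    · exact .of_forall fun x => by
        rw [Real.norm_of_nonneg (f x).2.1]; exact (f x).2.2
  have hall : ∀ f : C(X, I), ∫ x, (f x : ℝ) ∂μ = ∫ x, (f x : ℝ) ∂ν := by
    intro f
    have := (hcont μ).ext_on (denseRange_denseSeq C(X, I)) (hcont ν)
      (by rintro _ ⟨k, rfl⟩; exact h k)
    exact congrFun this f
  refine ext_of_forall_integral_eq_of_IsFiniteMeasure fun f => ?_
  -- The summand 1 keeps `c` positive when `f = 0`, so that `f` can be rescaled affinely into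
  -- `[0,1]`.
  set c : ℝ := ‖f‖ + 1 with hc
  have hc0 : 0 < c := by positivity
  have hb : ∀ x, |f x| ≤ c := fun x => (f.norm_coe_le_norm x).trans (by linarith)
  let g : C(X, I) := ⟨fun x => ⟨(f x + c) / (2 * c), by
    have := abs_le.1 (hb x)
    constructor
    · exact div_nonneg (by linarith) (by linarith)
    · rw [div_le_one (by linarith)]; linarith⟩, by
      refine Continuous.subtype_mk ?_ _
      fun_prop⟩
  have hg : ∀ x, f x = 2 * c * (g x : ℝ) - c := fun x => by
    change f x = 2 * c * ((f x + c) / (2 * c)) - c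
    field_simp
    ring
  have hint : ∀ (ρ : Measure X) [IsFiniteMeasure ρ], Integrable (fun x => (g x : ℝ)) ρ := by
    intro ρ _
    exact Integrable.of_bound (by fun_prop : Continuous fun x => (g x : ℝ)).aestronglyMeasurable 1
      (.of_forall fun x => by rw [Real.norm_of_nonneg (g x).2.1]; exact (g x).2.2)
  -- The measures are only finite; the constant function 1 shows that their total masses agree.
  have h1 := hall (ContinuousMap.const X 1)
  simp only [ContinuousMap.const_apply, Icc.coe_one, integral_const, smul_eq_mul, mul_one] at h1
  simp_rw [hg]
  rw [integral_sub ((hint μ).const_mul _) (integrable_const _),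
    integral_sub ((hint ν).const_mul _) (integrable_const _), integral_const_mul,
    integral_const_mul, hall g, integral_const, integral_const, h1]

theorem measurable_integral_probabilityMeasure {S : Type*} [MeasurableSpace S] {f : S → ℝ}
    (hf : Measurable f) :
    Measurable fun q : ProbabilityMeasure S => ∫ x, f x ∂(q : Measure S) := by
  let κ : ProbabilityTheory.Kernel (ProbabilityMeasure S) S :=
    ⟨fun q => (q : Measure S), measurable_subtype_coe⟩
  have : ProbabilityTheory.IsMarkovKernel κ :=
    ⟨fun q => inferInstanceAs (IsProbabilityMeasure (q : Measure S))⟩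
  exact (hf.stronglyMeasurable.integral_kernel (κ := κ)).measurable

/-- P(X) is compact, so a continuous injection into a Hausdorff space is an embedding. -/
theorem isEmbedding_integral_testFun :
    IsEmbedding fun (q : ProbabilityMeasure X) (k : ℕ) =>
      ∫ x, (testFun X k x : ℝ) ∂(q : Measure X) := by
  refine (Continuous.isClosedEmbedding ?_ ?_).isEmbedding
  · refine continuous_pi fun k => ?_
    exact ProbabilityMeasure.continuous_integral_continuousMap
      (⟨fun x => (testFun X k x : ℝ), by fun_prop⟩ : C(X, ℝ))
  · intro p q h
    exact ProbabilityMeasure.toMeasure_injective (Measure.ext_of_integral_testFun fun k => congrFun h k)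

/-- On a compact metrizable space, the `σ`-algebra of `P(X)` is the Borel `σ`-algebra of the weak
topology. -/
instance borelSpace_probabilityMeasure : BorelSpace (ProbabilityMeasure X) := by
  refine ⟨le_antisymm ?_ ?_⟩
  · have h : @Measurable _ _ (borel (ProbabilityMeasure X)) _
        (id : ProbabilityMeasure X → ProbabilityMeasure X) := by
      let _ := borel (ProbabilityMeasure X)
      exact @measurable_probabilityMeasure_of_isOpen X _ _ _ _ _ (borel (ProbabilityMeasure X)) id
        fun U hU => MeasurableSpace.measurableSet_generateFrom hU
    intro A hA
    exact h hA
  -- The weak topology is induced by countably many integrals, each of which is measurable for the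
  -- σ-algebra of evaluations.
  · rw [isEmbedding_integral_testFun.eq_induced, borel_comap, ← BorelSpace.measurable_eq (α := ℕ → ℝ)]
    refine Measurable.comap_le (measurable_pi_lambda _ fun k => ?_)
    exact measurable_integral_probabilityMeasure (by fun_prop)

end TestFunctions

/-! ### Dyadic times -/

/-- The dyadic number `k / 2 ^ n`, cut off at `1`. -/
noncomputable def dyadicPt (n k : ℕ) : I :=
  ⟨min 1 ((k : ℝ) / 2 ^ n), le_min zero_le_one (by positivity), min_le_left _ _⟩

/-- The dyadic times in `[0,1]`. -/
abbrev DyadicTime : Type := {t : I // ∃ n k, dyadicPt n k = t}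

instance : Countable DyadicTime :=
  ((countable_range fun p : ℕ × ℕ => dyadicPt p.1 p.2).mono (by
    rintro _ ⟨n, k, rfl⟩; exact ⟨(n, k), rfl⟩)).to_subtype

/-- The dyadic number `k / 2 ^ n`, cut off at `1`, as a dyadic time. -/
noncomputable def dyadicTime (n k : ℕ) : DyadicTime := ⟨dyadicPt n k, n, k, rfl⟩

theorem dyadicTime_mono (n : ℕ) : Monotone (dyadicTime n) := by
  intro j k h
  change min 1 ((j : ℝ) / 2 ^ n) ≤ min 1 ((k : ℝ) / 2 ^ n)
  gcongr

theorem dyadicTime_of_le {n k : ℕ} (h : 2 ^ n ≤ k) : (dyadicTime n k : I) = 1 := by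
  refine Subtype.ext (min_eq_left ?_)
  rw [one_le_div (by positivity)]
  exact_mod_cast h

/-- A dyadic time lies on every sufficiently fine grid. The bound on the index keeps it within the
finite horizon used for Doob's inequalities. -/
theorem DyadicTime.eventually_eq (d : DyadicTime) :
    ∀ᶠ n in atTop, ∃ k ≤ 2 ^ n, dyadicTime n k = d := by
  obtain ⟨_, m, j, rfl⟩ := d
  filter_upwards [eventually_ge_atTop m] with n hn
  rcases le_total (j * 2 ^ (n - m)) (2 ^ n) with h | h
  · refine ⟨j * 2 ^ (n - m), h, Subtype.ext (Subtype.ext ?_)⟩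
    change min 1 (((j * 2 ^ (n - m) : ℕ) : ℝ) / 2 ^ n) = min 1 ((j : ℝ) / 2 ^ m)
    obtain ⟨i, rfl⟩ := Nat.exists_eq_add_of_le hn
    congr 1
    simp only [Nat.add_sub_cancel_left, Nat.cast_mul, Nat.cast_pow, Nat.cast_ofNat, pow_add]
    field_simp
  · refine ⟨2 ^ n, le_rfl, Subtype.ext ?_⟩
    rw [dyadicTime_of_le le_rfl]
    refine Subtype.ext (Eq.symm (min_eq_left ?_))
    rw [one_le_div (by positivity)]
    obtain ⟨i, rfl⟩ := Nat.exists_eq_add_of_le hn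
    simp only [Nat.add_sub_cancel_left, pow_add] at h
    have : 2 ^ m ≤ j := Nat.le_of_mul_le_mul_right h (by positivity)
    exact_mod_cast this

/-- The smallest dyadic number of level `n` that is greater than `t`, or `1` if `t = 1`. -/
noncomputable def nextDyadic (n : ℕ) (t : I) : DyadicTime :=
  dyadicTime n (⌊(t : ℝ) * 2 ^ n⌋₊ + 1)

theorem dyadicTime_floor_le (n : ℕ) (t : I) :
    (dyadicTime n ⌊(t : ℝ) * 2 ^ n⌋₊ : I) ≤ t := by
  refine (min_le_right (1 : ℝ) _).trans ?_
  rw [div_le_iff₀ (by positivity)]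
  exact Nat.floor_le (mul_nonneg t.2.1 (by positivity))

theorem lt_nextDyadic (n : ℕ) {t : I} (ht : t < 1) : t < nextDyadic n t := by
  refine lt_min (show (t : ℝ) < 1 from ht) ?_
  rw [lt_div_iff₀ (by positivity)]
  exact_mod_cast Nat.lt_floor_add_one ((t : ℝ) * 2 ^ n)

theorem nextDyadic_one (n : ℕ) : (nextDyadic n 1 : I) = 1 := by
  refine dyadicTime_of_le ?_
  have : (((1 : I) : ℝ) * 2 ^ n) = ((2 ^ n : ℕ) : ℝ) := by push_cast; simp
  rw [this, Nat.floor_natCast]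
  exact Nat.le_succ _

theorem le_nextDyadic (n : ℕ) (t : I) : t ≤ nextDyadic n t := by
  rcases eq_or_lt_of_le (show t ≤ 1 from t.2.2) with rfl | h
  · exact (nextDyadic_one n).ge
  · exact (lt_nextDyadic n h).le

theorem nextDyadic_mono (n : ℕ) : Monotone (nextDyadic n) := fun s t h =>
  dyadicTime_mono n (Nat.add_le_add_right (Nat.floor_le_floor (by
    have : (s : ℝ) ≤ t := h
    gcongr)) 1)

theorem nextDyadic_le (n : ℕ) (t : I) : ((nextDyadic n t : I) : ℝ) ≤ t + (1 / 2) ^ n := by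
  refine (min_le_right _ _).trans ?_
  rw [div_le_iff₀ (by positivity), add_mul, ← mul_pow]
  have := Nat.floor_le (mul_nonneg t.2.1 (by positivity : (0 : ℝ) ≤ 2 ^ n))
  push_cast
  norm_num
  linarith

theorem tendsto_nextDyadic (t : I) :
    Tendsto (fun n => (nextDyadic n t : I)) atTop (𝓝[≥] t) := by
  refine tendsto_nhdsWithin_iff.2 ⟨?_, .of_forall fun n => le_nextDyadic n t⟩
  rw [tendsto_subtype_rng]
  refine tendsto_of_tendsto_of_tendsto_of_le_of_le tendsto_const_nhds
    (h := fun n => (t : ℝ) + (1 / 2) ^ n) ?_ (fun n => le_nextDyadic n t)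
    (fun n => nextDyadic_le n t)
  simpa using (tendsto_pow_atTop_nhds_zero_of_lt_one (by norm_num)
    (by norm_num : (1 / 2 : ℝ) < 1)).const_add (t : ℝ)

/-- The floor function is locally constant to the right; this makes the step paths
`CadlagPath.ofDyadic` right continuous. -/
theorem tendsto_nextDyadic_nhdsGE (n : ℕ) (t : I) :
    Tendsto (nextDyadic n) (𝓝[≥] t) (pure (nextDyadic n t)) := by
  have h1 : Tendsto (fun s : I => (s : ℝ) * 2 ^ n) (𝓝[≥] t) (𝓝[≥] ((t : ℝ) * 2 ^ n)) := by
    refine tendsto_nhdsWithin_iff.2 ⟨?_, ?_⟩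
    · exact ((by fun_prop : Continuous fun s : I => (s : ℝ) * 2 ^ n).tendsto t).mono_left
        nhdsWithin_le_nhds
    · filter_upwards [self_mem_nhdsWithin] with s hs
      have : (t : ℝ) ≤ s := hs
      exact mul_le_mul_of_nonneg_right this (by positivity)
  have h2 := (tendsto_floor_right_pure_floor ((t : ℝ) * 2 ^ n)).comp h1
  rw [tendsto_pure] at h2 ⊢
  filter_upwards [h2] with s hs
  simp only [Function.comp_apply] at hs
  rw [nextDyadic, nextDyadic, ← Int.floor_toNat, ← Int.floor_toNat, hs]

theorem exists_tendsto_nextDyadic_nhdsLT (n : ℕ) (t : I) :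
    ∃ d, Tendsto (nextDyadic n) (𝓝[<] t) (pure d) := by
  have h1 : Tendsto (fun s : I => (s : ℝ) * 2 ^ n) (𝓝[<] t) (𝓝[<] ((t : ℝ) * 2 ^ n)) := by
    refine tendsto_nhdsWithin_iff.2 ⟨?_, ?_⟩
    · exact ((by fun_prop : Continuous fun s : I => (s : ℝ) * 2 ^ n).tendsto t).mono_left
        nhdsWithin_le_nhds
    · filter_upwards [self_mem_nhdsWithin] with s hs
      have : (s : ℝ) < t := hs
      exact mul_lt_mul_of_pos_right this (by positivity)
  have h2 := (tendsto_floor_left_pure_ceil_sub_one ((t : ℝ) * 2 ^ n)).comp h1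
  refine ⟨dyadicTime n ((⌈(t : ℝ) * 2 ^ n⌉ - 1).toNat + 1), ?_⟩
  rw [tendsto_pure] at h2 ⊢
  filter_upwards [h2] with s hs
  simp only [Function.comp_apply] at hs
  rw [nextDyadic, ← Int.floor_toNat, hs]

/-! ### The topology of `D(X)` -/

instance : IsProbabilityMeasure mzMeasure := ⟨by
  simp only [mzMeasure, Measure.smul_apply, Measure.add_apply, measure_univ, smul_eq_mul]
  rw [one_add_one_eq_two, ENNReal.inv_mul_cancel (by norm_num) (by norm_num)]⟩

/-- The measure λ has an atom at 1. -/
theorem ae_mzMeasure_one {p : I → Prop} (h : ∀ᵐ t ∂mzMeasure, p t) : p 1 := by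
  rw [mzMeasure, Measure.ae_ennreal_smul_measure_iff (by norm_num), ae_add_measure_iff] at h
  rw [ae_dirac_eq] at h
  exact h.2

namespace CadlagPath

theorem ext {X : Type*} [TopologicalSpace X] {f g : CadlagPath X} (h : ∀ t, f t = g t) :
    f = g := by
  cases f
  cases g
  congr
  exact funext h

section Basic

variable {X : Type*} [TopologicalSpace X]

/-- The path of level `n` that is built from the values at dyadic times. -/
noncomputable def ofDyadic (n : ℕ) (q : DyadicTime → X) : CadlagPath X where
  toFun t := q (nextDyadic n t)
  rightCont t := Tendsto.mono_right
    ((tendsto_pure_pure q _).comp (tendsto_nextDyadic_nhdsGE n t)) (pure_le_nhds _)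
  leftLim t := by
    obtain ⟨d, hd⟩ := exists_tendsto_nextDyadic_nhdsLT n t
    exact ⟨q d, ((tendsto_pure_pure q _).comp hd).mono_right (pure_le_nhds _)⟩

/-- The restriction of a path to the dyadic times. -/
def restrictDyadic (f : CadlagPath X) (d : DyadicTime) : X := f d

theorem tendsto_nextDyadic (f : CadlagPath X) (t : I) :
    Tendsto (fun n => f (nextDyadic n t)) atTop (𝓝 (f t)) :=
  (f.rightCont t).tendsto.comp (_root_.tendsto_nextDyadic t)

variable [MetrizableSpace X]

theorem stronglyMeasurable (f : CadlagPath X) : StronglyMeasurable (f : I → X) := by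
  refine stronglyMeasurable_of_tendsto atTop (f := fun n t => f (nextDyadic n t)) (fun n => ?_)
    (tendsto_pi_nhds.2 fun t => f.tendsto_nextDyadic t)
  have h1 : Measurable fun t : I => ⌊(t : ℝ) * 2 ^ n⌋₊ + 1 := by fun_prop
  have h2 : StronglyMeasurable fun k : ℕ => f (dyadicTime n k) := .of_discrete
  exact h2.comp_measurable h1

/-- This is the subsequence criterion for convergence in measure. It mentions only the topology of
`X`, so later arguments can be pointwise and metric-free. -/
theorem tendsto_iff_forall_subseq (u : ℕ → CadlagPath X) (f : CadlagPath X) :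
    Tendsto u atTop (𝓝 f) ↔ ∀ ns : ℕ → ℕ, StrictMono ns → ∃ ns' : ℕ → ℕ, StrictMono ns' ∧
      ∀ᵐ t ∂mzMeasure, Tendsto (fun i => u (ns (ns' i)) t) atTop (𝓝 (f t)) := by
  let _ := metrizableSpaceMetric X
  exact (kyFan_tendsto_iff u f).trans
    (exists_seq_tendstoInMeasure_atTop_iff fun n => (u n).stronglyMeasurable.aestronglyMeasurable)

theorem exists_subseq_of_tendsto {u : ℕ → CadlagPath X} {f : CadlagPath X}
    (h : Tendsto u atTop (𝓝 f)) : ∃ ns : ℕ → ℕ, StrictMono ns ∧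
      ∀ᵐ t ∂mzMeasure, Tendsto (fun i => u (ns i) t) atTop (𝓝 (f t)) :=
  (tendsto_iff_forall_subseq u f).1 h id strictMono_id

theorem tendsto_of_tendsto_ae {u : ℕ → CadlagPath X} {f : CadlagPath X}
    (h : ∀ᵐ t ∂mzMeasure, Tendsto (fun i => u i t) atTop (𝓝 (f t))) : Tendsto u atTop (𝓝 f) :=
  (tendsto_iff_forall_subseq u f).2 fun _ hns => ⟨id, strictMono_id, by
    filter_upwards [h] with t ht
    exact ht.comp hns.tendsto_atTop⟩

instance : PseudoMetrizableSpace (CadlagPath X) := by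
  let _ := metrizableSpaceMetric X
  let _ := kyFan X
  exact inferInstanceAs (@PseudoMetrizableSpace (CadlagPath X)
    (kyFan X).toUniformSpace.toTopologicalSpace)

/-- λ charges every right neighbourhood of every time, and right-continuous paths that differ at `t`
differ on a right neighbourhood of `t`. -/
theorem eq_of_ae_eq {f g : CadlagPath X} (h : ∀ᵐ t ∂mzMeasure, f t = g t) : f = g := by
  refine ext fun t => ?_
  by_contra hne
  obtain ⟨U, V, hU, hV, hfU, hgV, hd⟩ := t2_separation hne
  have hmem : {s | ¬ f s = g s} ∈ 𝓝[≥] t := by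
    filter_upwards [(f.rightCont t).preimage_mem_nhdsWithin (hU.mem_nhds hfU),
      (g.rightCont t).preimage_mem_nhdsWithin (hV.mem_nhds hgV)] with s h1 h2 h3
    exact disjoint_left.1 hd h1 (by rw [h3]; exact h2)
  exact mzMeasure_pos hmem (ae_iff.1 h)

instance : MetrizableSpace (CadlagPath X) := by
  have : T0Space (CadlagPath X) := ⟨fun f g h => by
    have h1 : Tendsto (fun _ : ℕ => f) atTop (𝓝 g) := by
      rw [← h.nhds_eq]
      exact tendsto_const_nhds
    obtain ⟨ns, -, hae⟩ := exists_subseq_of_tendsto h1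
    refine eq_of_ae_eq ?_
    filter_upwards [hae] with t ht
    exact tendsto_nhds_unique tendsto_const_nhds ht⟩
  exact inferInstance

/-- Almost everywhere convergence along a subsequence includes the time 1, because λ has an atom
there. This underlies the continuity of `terminalIntensity`. -/
theorem continuous_eval_one : Continuous fun f : CadlagPath X => f 1 := by
  refine continuous_iff_seqContinuous.2 fun u f h => tendsto_of_subseq_tendsto fun ns hns => ?_
  obtain ⟨ms, -, hae⟩ := exists_subseq_of_tendsto (h.comp hns)
  exact ⟨ms, ae_mzMeasure_one hae⟩

theorem continuous_ofDyadic (n : ℕ) : Continuous (ofDyadic (X := X) n) := by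
  refine continuous_iff_seqContinuous.2 fun u q h => tendsto_of_tendsto_ae (.of_forall fun t => ?_)
  exact (tendsto_pi_nhds.1 h) (nextDyadic n t)

theorem tendsto_ofDyadic (f : CadlagPath X) :
    Tendsto (fun n => ofDyadic n f.restrictDyadic) atTop (𝓝 f) :=
  tendsto_of_tendsto_ae (.of_forall fun t => f.tendsto_nextDyadic t)

/-- Step paths are dense and form a continuous image of the separable space of pairs of a level and
a family of dyadic values. -/
instance [SecondCountableTopology X] : SecondCountableTopology (CadlagPath X) := by
  let _ := pseudoMetrizableSpacePseudoMetric (CadlagPath X)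
  have hcont : Continuous fun p : ℕ × (DyadicTime → X) => ofDyadic p.1 p.2 := by
    rw [continuous_prod_of_discrete_left]
    exact fun n => continuous_ofDyadic n
  have hdense : DenseRange fun p : ℕ × (DyadicTime → X) => ofDyadic p.1 p.2 := fun f =>
    mem_closure_of_tendsto f.tendsto_ofDyadic
      (.of_forall fun n => ⟨(n, f.restrictDyadic), rfl⟩)
  have := hdense.separableSpace hcont
  exact UniformSpace.secondCountable_of_separable _

theorem measurable_of_forall_dyadic [SecondCountableTopology X] [MeasurableSpace X] [BorelSpace X]
    {Ω : Type*} [MeasurableSpace Ω] {Ψ : Ω → CadlagPath X}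
    (h : ∀ d : DyadicTime, Measurable fun ω => Ψ ω d) : Measurable Ψ := by
  refine measurable_of_tendsto_metrizable (f := fun n ω => ofDyadic n (Ψ ω).restrictDyadic)
    (fun n => ?_) (tendsto_pi_nhds.2 fun ω => (Ψ ω).tendsto_ofDyadic)
  exact (continuous_ofDyadic n).measurable.comp (measurable_pi_lambda _ h)

theorem measurable_eval [MeasurableSpace X] [BorelSpace X] (t : I) :
    Measurable fun f : CadlagPath X => f t :=
  measurable_of_isOpen fun _ hU => measurableSet_eval_mem t hU

end Basic

section Map

variable {X Y : Type*} [TopologicalSpace X] [TopologicalSpace Y]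

/-- Composition of paths with a continuous map. -/
def map {ι : X → Y} (hι : Continuous ι) (f : CadlagPath X) : CadlagPath Y where
  toFun t := ι (f t)
  rightCont t := hι.continuousAt.comp_continuousWithinAt (f.rightCont t)
  leftLim t := (f.leftLim t).imp' ι fun l hl => (hι.tendsto l).comp hl

theorem map_apply {ι : X → Y} (hι : Continuous ι) (f : CadlagPath X) (t : I) :
    f.map hι t = ι (f t) := rfl

variable [MetrizableSpace X] [MetrizableSpace Y]

theorem continuous_map {ι : X → Y} (hι : Continuous ι) : Continuous (map hι) := by
  refine continuous_iff_seqContinuous.2 fun u f h => ?_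
  refine (tendsto_iff_forall_subseq _ _).2 fun ns hns => ?_
  obtain ⟨ms, hms, hae⟩ := (tendsto_iff_forall_subseq u f).1 h ns hns
  refine ⟨ms, hms, ?_⟩
  filter_upwards [hae] with t ht
  exact (hι.tendsto _).comp ht

theorem isEmbedding_map {ι : X → Y} (hι : IsEmbedding ι) : IsEmbedding (map hι.continuous) := by
  refine ⟨isInducing_iff_nhds.2 fun f => le_antisymm
    (continuous_map hι.continuous).continuousAt.le_comap ?_, fun f g h => ext fun t =>
      hι.injective (by rw [← map_apply hι.continuous, h, map_apply])⟩
  refine tendsto_of_seq_tendsto (f := id)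
    (k := comap (map hι.continuous) (𝓝 (map hι.continuous f))) fun u hu => ?_
  refine (tendsto_iff_forall_subseq _ _).2 fun ns hns => ?_
  obtain ⟨ms, hms, hae⟩ :=
    (tendsto_iff_forall_subseq _ _).1 (tendsto_comap_iff.1 hu) ns hns
  refine ⟨ms, hms, ?_⟩
  filter_upwards [hae] with t ht
  exact hι.isInducing.tendsto_nhds_iff.2 ht

end Map

end CadlagPath

/-! ### Oscillations and upcrossings -/

section Oscillation

variable {α : Type*} [LinearOrder α]

/-- Between `l` and `r`, the function `h` goes at least `K` times from below `a` to above `b`. -/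
def HasUpcrossings (h : α → ℝ) (a b : ℝ) : ℕ → α → α → Prop
  | 0, l, r => l ≤ r
  | K + 1, l, r => ∃ s t, l ≤ s ∧ s < t ∧ h s ≤ a ∧ b ≤ h t ∧ HasUpcrossings h a b K t r

theorem HasUpcrossings.mono_left {h : α → ℝ} {a b : ℝ} {K : ℕ} {l l' r : α}
    (H : HasUpcrossings h a b K l r) (hl : l' ≤ l) : HasUpcrossings h a b K l' r := by
  cases K with
  | zero => exact hl.trans H
  | succ K =>
    obtain ⟨s, t, h1, h2⟩ := H
    exact ⟨s, t, hl.trans h1, h2⟩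

theorem HasUpcrossings.of_frequently_left {h : α → ℝ} {a b : ℝ} {L : Filter α} {A : Set α}
    (hA : ∀ l ∈ A, ∀ᶠ v in L, l < v ∧ v ∈ A) (ha : ∃ᶠ v in L, h v < a) (hb : ∃ᶠ v in L, b < h v)
    (K : ℕ) {l : α} (hl : l ∈ A) : ∃ r, HasUpcrossings h a b K l r := by
  induction K generalizing l with
  | zero => exact ⟨l, le_rfl⟩
  | succ K ih =>
    obtain ⟨s, has, hls, hs⟩ := (ha.and_eventually (hA l hl)).exists
    obtain ⟨t, hbt, hst, ht⟩ := (hb.and_eventually (hA s hs)).exists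
    obtain ⟨r, hr⟩ := ih ht
    exact ⟨r, s, t, hls.le, hst, has.le, hbt.le, hr⟩

theorem HasUpcrossings.of_frequently_right {h : α → ℝ} {a b : ℝ} {L : Filter α} {A : Set α}
    (hA : ∀ r ∈ A, ∀ᶠ v in L, v < r ∧ v ∈ A) (ha : ∃ᶠ v in L, h v < a) (hb : ∃ᶠ v in L, b < h v)
    (K : ℕ) {r : α} (hr : r ∈ A) : ∃ l ∈ A, HasUpcrossings h a b K l r := by
  induction K with
  | zero => exact ⟨r, hr, le_rfl⟩
  | succ K ih =>
    obtain ⟨l, hl, H⟩ := ih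
    obtain ⟨t, hbt, htl, ht⟩ := (hb.and_eventually (hA l hl)).exists
    obtain ⟨s, has, hst, hs⟩ := (ha.and_eventually (hA t ht)).exists
    exact ⟨s, hs, s, t, le_rfl, hst, has.le, hbt.le, H.mono_left htl.le⟩

theorem HasUpcrossings.le_upcrossingsBefore {Ω : Type*} {f : ℕ → Ω → ℝ} {ω : Ω} {a b : ℝ}
    (hab : a < b) {K l r N : ℕ} (H : HasUpcrossings (fun i => f i ω) a b K l r) (hr : r < N) :
    K ≤ upcrossingsBefore a b f N ω := by
  -- If `n` upcrossings are completed by time `l` and `K` more occur between `l` and `r`, then `n +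
  -- K` are completed by time `r`.
  have key : ∀ K l n, HasUpcrossings (fun i => f i ω) a b K l r →
      upperCrossingTime a b f N n ω ≤ l → upperCrossingTime a b f N (n + K) ω ≤ r := by
    intro K
    induction K with
    | zero => exact fun l n H hl => hl.trans H
    | succ K ih =>
      rintro l n ⟨s, t, hls, hst, hs, ht, H⟩ hl
      have htr : t ≤ r := by
        clear ih ht hst hr
        induction K generalizing t with
        | zero => exact H
        | succ K ih =>
          obtain ⟨s', t', h1, h2, -, -, H'⟩ := H
          exact (h1.trans h2.le).trans (ih t' H')
      have h1 : lowerCrossingTime a b f N n ω ≤ s :=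
        hittingBtwn_le_of_mem (hl.trans hls) (by omega) hs
      have h2 : upperCrossingTime a b f N (n + 1) ω ≤ t := by
        rw [upperCrossingTime_succ_eq]
        exact hittingBtwn_le_of_mem (h1.trans hst.le) (by omega) ht
      have := ih t (n + 1) H h2
      rwa [show n + (K + 1) = n + 1 + K by ring]
  refine le_csSup (upperCrossingTime_lt_bddAbove hab) ?_
  have := key K l 0 H (by simp)
  rw [zero_add] at this
  exact lt_of_le_of_lt this hr

end Oscillation

/-- A finite pattern involves finitely many times, all of which lie on every fine grid. Recording
the left endpoint allows the patterns to be concatenated in the induction. -/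
theorem HasUpcrossings.eventually_dyadic {h : DyadicTime → ℝ} {a b : ℝ} {K : ℕ}
    {l r : DyadicTime} (H : HasUpcrossings h a b K l r) :
    ∀ᶠ n in atTop, ∃ i j, dyadicTime n i = l ∧ j ≤ 2 ^ n ∧
      HasUpcrossings (fun i => h (dyadicTime n i)) a b K i j := by
  have hlt : ∀ {n i j : ℕ}, dyadicTime n i < dyadicTime n j → i < j := fun {n i j} hij => by
    by_contra hc
    exact absurd (dyadicTime_mono n (not_lt.1 hc)) (not_le.2 hij)
  induction K generalizing l with
  | zero =>
    filter_upwards [l.eventually_eq, r.eventually_eq] with n ⟨i, _, hi'⟩ ⟨j, hj, hj'⟩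
    rcases eq_or_lt_of_le (show l ≤ r from H) with rfl | hlr
    · exact ⟨j, j, hj', hj, le_rfl⟩
    · exact ⟨i, j, hi', hj, (hlt (by rwa [hi', hj'])).le⟩
  | succ K ih =>
    obtain ⟨s, t, hls, hst, hs, ht, H⟩ := H
    filter_upwards [ih H, l.eventually_eq, s.eventually_eq]
      with n ⟨t', j, ht', hj, H'⟩ ⟨i, _, hi'⟩ ⟨s', _, hs'⟩
    have h1 : s' < t' := hlt (by rwa [hs', ht'])
    have h2 : h (dyadicTime n s') ≤ a := by rwa [hs']
    have h3 : b ≤ h (dyadicTime n t') := by rwa [ht']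
    rcases eq_or_lt_of_le hls with rfl | hls
    · exact ⟨s', j, hs', hj, s', t', le_rfl, h1, h2, h3, H'⟩
    · exact ⟨i, j, hi', hj, s', t', (hlt (by rwa [hi', hs'])).le, h1, h2, h3, H'⟩

/-- The number of upcrossings of `(a, b)` by a process along the dyadic times of level `n`. -/
noncomputable def dyadicUpcrossings {Ω : Type*} (M : DyadicTime → Ω → ℝ) (a b : ℝ) (n : ℕ) :
    Ω → ℕ :=
  -- The horizon is strict, so `2 ^ n + 1` admits the index `2 ^ n`, which is the time 1.
  upcrossingsBefore a b (fun i => M (dyadicTime n i)) (2 ^ n + 1)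

theorem HasUpcrossings.eventually_le {Ω : Type*} {M : DyadicTime → Ω → ℝ} {ω : Ω} {a b : ℝ}
    (hab : a < b) {K : ℕ} {l r : DyadicTime} (H : HasUpcrossings (fun d => M d ω) a b K l r) :
    ∀ᶠ n in atTop, K ≤ dyadicUpcrossings M a b n ω := by
  filter_upwards [H.eventually_dyadic] with n ⟨i, j, _, hj, H'⟩
  exact HasUpcrossings.le_upcrossingsBefore hab H' (Nat.lt_succ_of_le hj)

/-- Oscillation at a one-sided limit point produces any number of upcrossings at dyadic times, and
each such pattern is seen at all large levels. Hence the lower limit of the counts would be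
infinite. -/
theorem not_frequently_of_liminf_lt_top {Ω : Type*} {M : DyadicTime → Ω → ℝ} {ω : Ω} {a b : ℝ}
    (hab : a < b) (h : liminf (fun n => (dyadicUpcrossings M a b n ω : ℝ≥0∞)) atTop < ⊤)
    {L : Filter DyadicTime}
    (hL : (∃ t : I, L = comap Subtype.val (𝓝[<] t)) ∨ ∃ t : I, L = comap Subtype.val (𝓝[>] t)) :
    ¬ ((∃ᶠ d in L, M d ω < a) ∧ ∃ᶠ d in L, b < M d ω) := by
  rintro ⟨ha, hb⟩
  have hK : ∀ K, ∃ l r, HasUpcrossings (fun d => M d ω) a b K l r := by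
    intro K
    rcases hL with ⟨t, rfl⟩ | ⟨t, rfl⟩
    · have hmem : ∀ᶠ v : DyadicTime in comap Subtype.val (𝓝[<] t), (v : I) < t :=
        preimage_mem_comap self_mem_nhdsWithin
      obtain ⟨l, -, hl⟩ := (ha.and_eventually hmem).exists
      have hA : ∀ l : DyadicTime, (l : I) < t →
          ∀ᶠ v : DyadicTime in comap Subtype.val (𝓝[<] t), l < v ∧ (v : I) < t := fun l hl =>
        preimage_mem_comap (Ioo_mem_nhdsLT hl)
      obtain ⟨r, hr⟩ := HasUpcrossings.of_frequently_left (A := {d : DyadicTime | (d : I) < t})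
        hA ha hb K hl
      exact ⟨l, r, hr⟩
    · have hmem : ∀ᶠ v : DyadicTime in comap Subtype.val (𝓝[>] t), t < (v : I) :=
        preimage_mem_comap self_mem_nhdsWithin
      obtain ⟨r, -, hr⟩ := (ha.and_eventually hmem).exists
      have hA : ∀ r : DyadicTime, t < (r : I) →
          ∀ᶠ v : DyadicTime in comap Subtype.val (𝓝[>] t), v < r ∧ t < (v : I) := fun r hr => by
        filter_upwards [preimage_mem_comap (Ioo_mem_nhdsGT hr)] with v hv using ⟨hv.2, hv.1⟩
      obtain ⟨l, -, hl⟩ := HasUpcrossings.of_frequently_right (A := {d : DyadicTime | t < (d : I)})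
        hA ha hb K hr
      exact ⟨l, r, hl⟩
  obtain ⟨K, hKlt⟩ := ENNReal.exists_nat_gt h.ne
  obtain ⟨l, r, H⟩ := hK K
  refine absurd (le_liminf_of_le (by isBoundedDefault) ?_) (not_le.2 hKlt)
  filter_upwards [H.eventually_le hab] with n hn
  exact_mod_cast hn

/-- A filtration along a sequence of times. -/
def MeasureTheory.Filtration.alongSeq {ι Ω : Type*} [Preorder ι] {m : MeasurableSpace Ω}
    (ℱ : Filtration ι m) (τ : ℕ → ι) (hτ : Monotone τ) : Filtration ℕ m where
  seq n := ℱ (τ n)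
  mono' _ _ h := ℱ.mono (hτ h)
  le' n := ℱ.le (τ n)

theorem MeasureTheory.Martingale.alongSeq {ι Ω : Type*} [Preorder ι] {m : MeasurableSpace Ω}
    {ℱ : Filtration ι m} {μ : Measure Ω} {M : ι → Ω → ℝ} (hM : Martingale M ℱ μ) {τ : ℕ → ι}
    (hτ : Monotone τ) : Martingale (fun n => M (τ n)) (ℱ.alongSeq τ hτ) μ :=
  ⟨fun n => hM.1 (τ n), fun _ _ h => hM.2 _ _ (hτ h)⟩

theorem measurable_dyadicUpcrossings {Ω : Type*} [m : MeasurableSpace Ω] {M : DyadicTime → Ω → ℝ}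
    (hM : ∀ d, Measurable (M d)) {a b : ℝ} (hab : a < b) (n : ℕ) :
    Measurable (dyadicUpcrossings M a b n) := by
  refine StronglyAdapted.measurable_upcrossingsBefore (ℱ := Filtration.const ℕ m le_rfl)
    (fun i => ?_) hab
  exact (hM (dyadicTime n i)).stronglyMeasurable

/-- Doob's upcrossing inequality bounds the expected counts uniformly in the level, and Fatou's
lemma passes to the lower limit. -/
theorem ae_liminf_dyadicUpcrossings_lt_top {Ω : Type*} {m : MeasurableSpace Ω} {μ : Measure Ω}
    [IsProbabilityMeasure μ] {ℱ : Filtration DyadicTime m} {M : DyadicTime → Ω → ℝ}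
    (hM : Martingale M ℱ μ) (h1 : ∀ d ω, |M d ω| ≤ 1) {a b : ℝ} (hab : a < b) :
    ∀ᵐ ω ∂μ, liminf (fun n => (dyadicUpcrossings M a b n ω : ℝ≥0∞)) atTop < ⊤ := by
  have hMm : ∀ d, Measurable (M d) := fun d => ((hM.1 d).mono (ℱ.le d)).measurable
  have hmeas : ∀ n, Measurable fun ω => (dyadicUpcrossings M a b n ω : ℝ≥0∞) := fun n =>
    measurable_from_top.comp (measurable_dyadicUpcrossings hMm hab n)
  have hbound : ∀ n, ∫⁻ ω, (dyadicUpcrossings M a b n ω : ℝ≥0∞) ∂μ ≤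
      ENNReal.ofReal ((1 + |a|) / (b - a)) := by
    intro n
    have hmart := hM.alongSeq (dyadicTime_mono n)
    have h2 := hmart.submartingale.mul_integral_upcrossingsBefore_le_integral_pos_part a b
      (2 ^ n + 1)
    have h3 : ∫ ω, (M (dyadicTime n (2 ^ n + 1)) ω - a)⁺ ∂μ ≤ 1 + |a| := by
      have hpt : ∀ ω, (M (dyadicTime n (2 ^ n + 1)) ω - a)⁺ ≤ 1 + |a| := fun ω =>
        max_le (by
          have := abs_le.1 (h1 (dyadicTime n (2 ^ n + 1)) ω)
          have := neg_abs_le a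
          linarith) (by positivity)
      calc _ ≤ ∫ _, (1 + |a|) ∂μ :=
            integral_mono_of_nonneg (.of_forall fun ω => posPart_nonneg _)
              (integrable_const _) (.of_forall hpt)
        _ = _ := by simp
    have h4 : ∫ ω, (dyadicUpcrossings M a b n ω : ℝ) ∂μ ≤ (1 + |a|) / (b - a) := by
      rw [le_div_iff₀ (sub_pos.2 hab), mul_comm]
      exact h2.trans h3
    have hint : Integrable (fun ω => (dyadicUpcrossings M a b n ω : ℝ)) μ :=
      hmart.1.integrable_upcrossingsBefore hab
    calc ∫⁻ ω, (dyadicUpcrossings M a b n ω : ℝ≥0∞) ∂μ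
        = ∫⁻ ω, ENNReal.ofReal (dyadicUpcrossings M a b n ω : ℝ) ∂μ := by
          simp only [ENNReal.ofReal_natCast]
      _ = ENNReal.ofReal (∫ ω, (dyadicUpcrossings M a b n ω : ℝ) ∂μ) :=
          (ofReal_integral_eq_lintegral_ofReal hint (.of_forall fun ω => Nat.cast_nonneg _)).symm
      _ ≤ _ := ENNReal.ofReal_le_ofReal h4
  refine ae_lt_top (Measurable.liminf hmeas) (ne_top_of_le_ne_top ?_ (lintegral_liminf_le hmeas))
  refine ne_top_of_le_ne_top ENNReal.ofReal_ne_top (b := ENNReal.ofReal ((1 + |a|) / (b - a))) ?_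
  exact liminf_le_of_le (by isBoundedDefault) fun c hc =>
    (hc.exists).elim fun n hn => hn.trans (hbound n)

/-! ### Regularization of functions on the dyadic times -/

section Regularization

variable {X : Type*} [TopologicalSpace X]

/-- The functions on the dyadic times that have finitely many oscillations along all `φ k`. -/
def regularizable (φ : ℕ → C(X, I)) : Set (DyadicTime → X) :=
  {q | ∀ k, ∀ a b : ℚ, a < b → liminf (fun n => (dyadicUpcrossings
    (fun d (q : DyadicTime → X) => (φ k (q d) : ℝ)) (a : ℝ) b n q : ℝ≥0∞)) atTop < ⊤}

theorem measurableSet_regularizable [MeasurableSpace X] [OpensMeasurableSpace X]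
    (φ : ℕ → C(X, I)) : MeasurableSet (regularizable φ) := by
  simp only [regularizable, ofPred_forall]
  refine .iInter fun k => .iInter fun a => .iInter fun b => .iInter fun hab => ?_
  refine measurableSet_lt (Measurable.liminf fun n => measurable_from_top.comp
    (measurable_dyadicUpcrossings (fun d => ?_) (by exact_mod_cast hab) n)) measurable_const
  exact (by fun_prop : Continuous fun x => (φ k x : ℝ)).measurable.comp (measurable_pi_apply d)

/-- By compactness the separating family embeds `X` as a closed subset of a countable product of
lines, so coordinatewise limits stay in the image. -/
theorem exists_tendsto_of_forall_tendsto [CompactSpace X] {φ : ℕ → C(X, I)}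
    (hφ : ∀ x y, (∀ k, φ k x = φ k y) → x = y) {α : Type*} [Nonempty α] {q : α → X}
    {L : Filter α} (h : ∀ k, ∃ c, Tendsto (fun d => (φ k (q d) : ℝ)) L (𝓝 c)) :
    ∃ x, Tendsto q L (𝓝 x) := by
  have hemb : IsClosedEmbedding fun (x : X) (k : ℕ) => (φ k x : ℝ) :=
    Continuous.isClosedEmbedding (by fun_prop) fun x y hxy =>
      hφ x y fun k => Subtype.ext (congrFun hxy k)
  rcases L.eq_or_neBot with rfl | hL
  · exact ⟨q (Classical.arbitrary α), tendsto_bot⟩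
  choose c hc using h
  have hlim : Tendsto (fun d k => (φ k (q d) : ℝ)) L (𝓝 c) := tendsto_pi_nhds.2 hc
  obtain ⟨x, hx⟩ := hemb.isClosed_range.mem_of_tendsto hlim
    (.of_forall fun d => mem_range_self (q d))
  refine ⟨x, hemb.isInducing.tendsto_nhds_iff.2 ?_⟩
  change Tendsto (fun d k => (φ k (q d) : ℝ)) L (𝓝 (fun k => (φ k x : ℝ)))
  rw [show (fun k => (φ k x : ℝ)) = c from hx]
  exact hlim

theorem exists_tendsto_of_mem_regularizable [CompactSpace X] {φ : ℕ → C(X, I)}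
    (hφ : ∀ x y, (∀ k, φ k x = φ k y) → x = y) {q : DyadicTime → X} (hq : q ∈ regularizable φ)
    {L : Filter DyadicTime}
    (hL : (∃ t : I, L = comap Subtype.val (𝓝[<] t)) ∨ ∃ t : I, L = comap Subtype.val (𝓝[>] t)) :
    ∃ x, Tendsto q L (𝓝 x) := by
  have : Nonempty DyadicTime := ⟨dyadicTime 0 0⟩
  refine exists_tendsto_of_forall_tendsto hφ fun k => ?_
  refine tendsto_of_no_upcrossings (s := range ((↑) : ℚ → ℝ)) Rat.denseRange_cast ?_
    (isBoundedUnder_of ⟨1, fun d => (φ k (q d)).2.2⟩)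
    (isBoundedUnder_of ⟨0, fun d => (φ k (q d)).2.1⟩)
  rintro _ ⟨a, rfl⟩ _ ⟨b, rfl⟩ hab
  exact not_frequently_of_liminf_lt_top hab (hq k a b (by exact_mod_cast hab)) hL

/-- The time `1` as a dyadic time. -/
noncomputable def dyadicOne : DyadicTime := nextDyadic 0 1

theorem dyadicOne_coe : (dyadicOne : I) = 1 := nextDyadic_one 0

theorem nextDyadic_one_eq (n : ℕ) : nextDyadic n 1 = dyadicOne :=
  Subtype.ext ((nextDyadic_one n).trans dyadicOne_coe.symm)

/-- The path is the right limit along dyadic times, except at time 1, where it keeps the given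
value. Its own one-sided limits are inherited from those of `q`. -/
theorem exists_cadlagPath_of_mem_regularizable [CompactSpace X] [T2Space X] {φ : ℕ → C(X, I)}
    (hφ : ∀ x y, (∀ k, φ k x = φ k y) → x = y) {q : DyadicTime → X} (hq : q ∈ regularizable φ) :
    ∃ z : CadlagPath X, ∀ t, Tendsto (fun n => q (nextDyadic n t)) atTop (𝓝 (z t)) := by
  have hR : ∀ t : I, ∃ y : X, (t = 1 → y = q dyadicOne) ∧
      Tendsto q (comap Subtype.val (𝓝[>] t)) (𝓝 y) := by
    intro t
    rcases eq_or_ne t 1 with rfl | ht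
    · refine ⟨q dyadicOne, fun _ => rfl, ?_⟩
      have : Ioi (1 : I) = ∅ := Ioi_eq_empty_iff.2 isMax_top
      rw [this, nhdsWithin_empty, comap_bot]
      exact tendsto_bot
    · obtain ⟨y, hy⟩ := exists_tendsto_of_mem_regularizable hφ hq (.inr ⟨t, rfl⟩)
      exact ⟨y, fun h => absurd h ht, hy⟩
  choose y hy1 hy using hR
  have hnext : ∀ t, Tendsto (fun n => q (nextDyadic n t)) atTop (𝓝 (y t)) := by
    intro t
    rcases eq_or_lt_of_le (show t ≤ 1 from t.2.2) with rfl | ht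
    · simp only [nextDyadic_one_eq, hy1 1 rfl]
      exact tendsto_const_nhds
    · refine (hy t).comp (tendsto_comap_iff.2 (tendsto_nhdsWithin_iff.2 ⟨?_, ?_⟩))
      · exact (tendsto_nextDyadic t).mono_right nhdsWithin_le_nhds
      · exact .of_forall fun n => lt_nextDyadic n ht
  -- A closed set that contains the dyadic values over an open set of times contains all values over
  -- it. Since closed neighbourhoods form a basis, limits along dyadic times become limits along all
  -- times.
  have hopen : ∀ O : Set I, IsOpen O → ∀ V : Set X, IsClosed V →
      (∀ d : DyadicTime, (d : I) ∈ O → q d ∈ V) → ∀ u ∈ O, y u ∈ V := by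
    intro O hO V hV h u hu
    refine hV.mem_of_tendsto (hnext u) ?_
    have h1 : Tendsto (fun n => (nextDyadic n u : I)) atTop (𝓝 u) :=
      (tendsto_nextDyadic u).mono_right nhdsWithin_le_nhds
    filter_upwards [h1 (hO.mem_nhds hu)] with n hn using h _ hn
  refine ⟨⟨y, fun t => ?_, fun t => ?_⟩, hnext⟩
  · refine (closed_nhds_basis (y t)).tendsto_right_iff.2 fun V hV => ?_
    obtain ⟨W, hW, hWV⟩ := mem_comap.1 (hy t hV.1)
    obtain ⟨U, hU, htU, hUW⟩ := mem_nhdsWithin.1 hW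
    have h2 := hopen (U ∩ Ioi t) (hU.inter isOpen_Ioi) V hV.2 fun d hd => hWV (hUW hd)
    filter_upwards [mem_nhdsWithin_of_mem_nhds (hU.mem_nhds htU), self_mem_nhdsWithin]
      with u hu hut
    rcases eq_or_lt_of_le (show t ≤ u from hut) with rfl | hlt
    · exact mem_of_mem_nhds hV.1
    · exact h2 u ⟨hu, hlt⟩
  · obtain ⟨l, hl⟩ := exists_tendsto_of_mem_regularizable hφ hq (.inl ⟨t, rfl⟩)
    refine ⟨l, (closed_nhds_basis l).tendsto_right_iff.2 fun V hV => ?_⟩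
    obtain ⟨W, hW, hWV⟩ := mem_comap.1 (hl hV.1)
    obtain ⟨U, hU, htU, hUW⟩ := mem_nhdsWithin.1 hW
    have h2 := hopen (U ∩ Iio t) (hU.inter isOpen_Iio) V hV.2 fun d hd => hWV (hUW hd)
    filter_upwards [mem_nhdsWithin_of_mem_nhds (hU.mem_nhds htU), self_mem_nhdsWithin]
      with u hu hut
    exact h2 u ⟨hu, hut⟩

open Classical in
/-- The càdlàg regularization of a function on the dyadic times. -/
noncomputable def regularize [CompactSpace X] [T2Space X] {φ : ℕ → C(X, I)}
    (hφ : ∀ x y, (∀ k, φ k x = φ k y) → x = y) (q : DyadicTime → X) : CadlagPath X :=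
  if hq : q ∈ regularizable φ then (exists_cadlagPath_of_mem_regularizable hφ hq).choose
  -- The default is a constant path that depends measurably on `q` and needs no chosen point of `X`.
  else .ofDyadic 0 fun _ => q dyadicOne

section

variable [CompactSpace X] {φ : ℕ → C(X, I)}

theorem tendsto_regularize [T2Space X] (hφ : ∀ x y, (∀ k, φ k x = φ k y) → x = y)
    {q : DyadicTime → X} (hq : q ∈ regularizable φ) (t : I) :
    Tendsto (fun n => q (nextDyadic n t)) atTop (𝓝 (regularize hφ q t)) := by
  rw [regularize, dif_pos hq]
  exact (exists_cadlagPath_of_mem_regularizable hφ hq).choose_spec t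

theorem regularize_restrictDyadic [T2Space X] (hφ : ∀ x y, (∀ k, φ k x = φ k y) → x = y)
    {z : CadlagPath X} (hz : z.restrictDyadic ∈ regularizable φ) :
    regularize hφ z.restrictDyadic = z :=
  CadlagPath.ext fun t => tendsto_nhds_unique (tendsto_regularize hφ hz t) (z.tendsto_nextDyadic t)

theorem measurable_regularize [MetrizableSpace X] [MeasurableSpace X] [BorelSpace X]
    (hφ : ∀ x y, (∀ k, φ k x = φ k y) → x = y) : Measurable (regularize hφ) := by
  classical
  refine CadlagPath.measurable_of_forall_dyadic fun d => ?_
  refine measurable_of_tendsto_metrizable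
    (f := fun n q => if q ∈ regularizable φ then q (nextDyadic n d) else q dyadicOne)
    (fun n => Measurable.ite (measurableSet_regularizable φ) (measurable_pi_apply _)
      (measurable_pi_apply _)) (tendsto_pi_nhds.2 fun q => ?_)
  by_cases hq : q ∈ regularizable φ
  · simpa only [if_pos hq] using tendsto_regularize hφ hq d
  · simp only [if_neg hq, regularize, dif_neg hq]
    exact tendsto_const_nhds

end

end Regularization

/-! ### Martingales in terms of finitely many times -/

section Filtration

variable {X : Type*} [MeasurableSpace X] {ι : Type} [Preorder ι] {Ω : Type*}

/-- The filtration generated by a process. -/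
def processFiltration {m : MeasurableSpace Ω} {Z : ι → Ω → X}
    (hZ : ∀ t, Measurable (Z t)) : Filtration ι m where
  seq t := ⨆ s ≤ t, MeasurableSpace.comap (Z s) inferInstance
  mono' _ _ h := biSup_mono fun _ hs => hs.trans h
  le' _ := iSup₂_le fun s _ => (hZ s).comap_le

theorem processFiltration_eq_comap {m : MeasurableSpace Ω} {Z : ι → Ω → X}
    (hZ : ∀ t, Measurable (Z t)) (s : ι) :
    processFiltration hZ s =
      MeasurableSpace.comap (fun ω (u : Iic s) => Z u ω) MeasurableSpace.pi := by
  change (⨆ r ≤ s, MeasurableSpace.comap (Z r) inferInstance) = _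
  rw [MeasurableSpace.pi, MeasurableSpace.comap_iSup, iSup_subtype]
  simp only [MeasurableSpace.comap_comp]
  rfl

end Filtration

section Cylinder

variable {X : Type*} [TopologicalSpace X] {ι : Type} [Preorder ι] {Ω : Type*}

/-- The martingale property of `φ(Z)`, tested against continuous functions of finitely many
coordinates of the past. -/
def IsCylinderMartingale {_ : MeasurableSpace Ω} (μ : Measure Ω) (Z : ι → Ω → X) (φ : C(X, I)) :
    Prop :=
  ∀ s t, s ≤ t → ∀ (κ : Type) [Fintype κ] (u : κ → ι), (∀ i, u i ≤ s) → ∀ g : C(κ → X, ℝ),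
    ∫ ω, (φ (Z t ω) : ℝ) * g (fun i => Z (u i) ω) ∂μ =
      ∫ ω, (φ (Z s ω) : ℝ) * g (fun i => Z (u i) ω) ∂μ

theorem abs_testFunction_le (φ : C(X, I)) (x : X) : |(φ x : ℝ)| ≤ 1 := by
  rw [abs_of_nonneg (φ x).2.1]
  exact (φ x).2.2

theorem sq_sub_testFunction_le (φ : C(X, I)) (x y : X) : ((φ x : ℝ) - φ y) ^ 2 ≤ 1 := by
  have h1 := (φ x).2
  have h2 := (φ y).2
  rw [sq_le_one_iff_abs_le_one, abs_le]
  constructor <;> linarith [h1.1, h1.2, h2.1, h2.2]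

theorem measurable_testFunction_comp [MeasurableSpace X] [OpensMeasurableSpace X]
    [MeasurableSpace Ω] {φ : C(X, I)} {f : Ω → X} (hf : Measurable f) :
    Measurable fun ω => (φ (f ω) : ℝ) :=
  (by fun_prop : Continuous fun x => (φ x : ℝ)).measurable.comp hf

theorem integrable_testFunction_comp [MeasurableSpace X] [OpensMeasurableSpace X]
    {_ : MeasurableSpace Ω} {μ : Measure Ω} [IsFiniteMeasure μ] {φ : C(X, I)} {f : Ω → X}
    (hf : Measurable f) : Integrable (fun ω => (φ (f ω) : ℝ)) μ :=
  .of_bound (measurable_testFunction_comp hf).aestronglyMeasurable 1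
    (.of_forall fun _ => abs_testFunction_le _ _)

variable [CompactSpace X] [MetrizableSpace X] [MeasurableSpace X] [BorelSpace X]
  {m : MeasurableSpace Ω} {μ : Measure Ω} [IsProbabilityMeasure μ] {Z : ι → Ω → X} {φ : C(X, I)}

/-- Weighting `μ` by the nonnegative densities `φ (Z s)` and `φ (Z t)` gives two finite measures.
Their images on the past up to `s` have equal finite-dimensional marginals, hence coincide, so the
martingale identity holds on every event of the past. -/
theorem IsCylinderMartingale.martingale (hZ : ∀ t, Measurable (Z t))
    (h : IsCylinderMartingale μ Z φ) :
    Martingale (fun t ω => (φ (Z t ω) : ℝ)) (processFiltration hZ) μ := by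
  have hadapt : ∀ t, Measurable[processFiltration hZ t] (Z t) := fun t =>
    measurable_iff_comap_le.2
      (le_iSup₂_of_le (f := fun s (_ : s ≤ t) => MeasurableSpace.comap (Z s) _) t le_rfl le_rfl)
  have hφ : ∀ t, StronglyMeasurable[processFiltration hZ t] fun ω => (φ (Z t ω) : ℝ) := fun t =>
    ((by fun_prop : Continuous fun x => (φ x : ℝ)).measurable.comp (hadapt t)).stronglyMeasurable
  refine ⟨hφ, fun s t hst => ?_⟩
  let e : Ω → Iic s → X := fun ω u => Z u ω
  have he : Measurable e := measurable_pi_lambda _ fun u => hZ u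
  let ρ : ι → Measure Ω := fun r => μ.withDensity fun ω => ENNReal.ofReal (φ (Z r ω))
  have hρ : ∀ r, IsFiniteMeasure (ρ r) := fun r =>
    isFiniteMeasure_withDensity_ofReal (integrable_testFunction_comp (hZ r)).2
  have hmap : (ρ t).map e = (ρ s).map e := by
    refine IsProjectiveLimit.unique (P := fun J : Finset (Iic s) => ((ρ s).map e).map J.restrict)
      (fun J => ?_) (fun J => rfl)
    refine ext_of_forall_integral_eq_of_IsFiniteMeasure fun f => ?_
    have hint : ∀ r, ∫ y, f y ∂((ρ r).map e).map J.restrict =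
        ∫ ω, (φ (Z r ω) : ℝ) * f (fun i : J => Z (i : Iic s) ω) ∂μ := by
      intro r
      rw [Measure.map_map (Finset.measurable_restrict J) he,
        integral_map ((Finset.measurable_restrict J).comp he).aemeasurable
          f.continuous.aestronglyMeasurable,
        integral_withDensity_eq_integral_toReal_smul
          (measurable_testFunction_comp (hZ r)).ennreal_ofReal
          (.of_forall fun _ => ENNReal.ofReal_lt_top)]
      refine integral_congr_ae (.of_forall fun ω => ?_)
      simp only [ENNReal.toReal_ofReal (φ (Z r ω)).2.1, smul_eq_mul]
      rfl
    rw [hint, hint]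
    exact h s t hst J (fun i => (i : Iic s)) (fun i => (i : Iic s).2) f.toContinuousMap
  refine (ae_eq_condExp_of_forall_setIntegral_eq ((processFiltration hZ).le s)
    (integrable_testFunction_comp (hZ t))
    (fun _ _ _ => (integrable_testFunction_comp (hZ s)).integrableOn) ?_
    (hφ s).aestronglyMeasurable).symm
  intro A hA _
  have hA' := (processFiltration hZ).le s A hA
  rw [processFiltration_eq_comap hZ s] at hA
  obtain ⟨B, hB, rfl⟩ := hA
  have hr : ∀ r, ∫ ω in e ⁻¹' B, (φ (Z r ω) : ℝ) ∂μ = ((ρ r).map e B).toReal := by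
    intro r
    rw [Measure.map_apply he hB, withDensity_apply _ (he hB),
      integral_eq_lintegral_of_nonneg_ae (.of_forall fun ω => (φ (Z r ω)).2.1)
        (measurable_testFunction_comp (hZ r)).aestronglyMeasurable]
  exact (hr s).trans ((congrArg (fun ρ => (ρ B).toReal) hmap.symm).trans (hr t).symm)

theorem MeasureTheory.Martingale.isCylinderMartingale {ℱ : Filtration ι m}
    (h : Martingale (fun t ω => (φ (Z t ω) : ℝ)) ℱ μ) (hZ : ∀ t, Measurable[ℱ t] (Z t)) :
    IsCylinderMartingale μ Z φ := by
  intro s t hst κ _ u hu g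
  have hpi : Measurable[ℱ s] fun ω i => Z (u i) ω :=
    @measurable_pi_lambda Ω κ _ (ℱ s) _ _ fun i => (hZ (u i)).mono (ℱ.mono (hu i)) le_rfl
  have hg : StronglyMeasurable[ℱ s] fun ω => g (fun i => Z (u i) ω) :=
    (g.continuous.measurable.comp hpi).stronglyMeasurable
  obtain ⟨C, hC⟩ := isCompact_univ.exists_bound_of_continuousOn g.continuous.continuousOn
  have hint : ∀ r, Integrable (fun ω => (φ (Z r ω) : ℝ) * g (fun i => Z (u i) ω)) μ := fun r =>
    (integrable_testFunction_comp ((hZ r).mono (ℱ.le r) le_rfl)).mul_bdd (c := C)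
      (hg.mono (ℱ.le s)).aestronglyMeasurable (.of_forall fun ω => hC _ (mem_univ _))
  have h1 := condExp_mul_of_stronglyMeasurable_right hg (hint t) (h.integrable t)
  rw [← integral_condExp (ℱ.le s)]
  refine integral_congr_ae ?_
  filter_upwards [h1, h.2 s t hst] with ω hω1 hω2
  exact hω1.trans (by rw [Pi.mul_apply, hω2])

end Cylinder

/-! ### Martingale laws on the dyadic times -/

theorem mzMeasure_floor_eq_le {m i : ℕ} (hi : i < 2 ^ m) :
    mzMeasure {t | ⌊(t : ℝ) * 2 ^ m⌋₊ = i} ≤ ENNReal.ofReal ((1 / 2) ^ m) := by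
  set A : Set I := {t | ⌊(t : ℝ) * 2 ^ m⌋₊ = i} with hA
  have h1 : (1 : I) ∉ A := by
    have : (((1 : I) : ℝ) * 2 ^ m) = ((2 ^ m : ℕ) : ℝ) := by push_cast; simp
    rw [hA, mem_ofPred_eq, this, Nat.floor_natCast]
    exact hi.ne'
  have hm : MeasurableSet A :=
    (by fun_prop : Measurable fun t : I => ⌊(t : ℝ) * 2 ^ m⌋₊) (measurableSet_singleton i)
  have hvol : (volume : Measure I) A ≤ ENNReal.ofReal ((1 / 2) ^ m) := by
    have hsub : A ⊆ Ico (dyadicPt m i) (dyadicPt m (i + 1)) := by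
      intro t ht
      have ht' : ⌊(t : ℝ) * 2 ^ m⌋₊ = i := ht
      have ht1 : t < 1 := lt_of_le_of_ne t.2.2 fun h => h1 (h ▸ ht)
      refine ⟨?_, ?_⟩
      · have := dyadicTime_floor_le m t
        rwa [ht'] at this
      · have := lt_nextDyadic m ht1
        rwa [nextDyadic, ht'] at this
    refine (measure_mono hsub).trans ?_
    rw [unitInterval.volume_Ico]
    refine ENNReal.ofReal_le_ofReal ?_
    have hle : (i : ℝ) / 2 ^ m ≤ 1 := by
      rw [div_le_one (by positivity)]
      exact_mod_cast hi.le
    have e1 : ((dyadicPt m i : I) : ℝ) = (i : ℝ) / 2 ^ m := min_eq_right hle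
    have e2 : ((dyadicPt m (i + 1) : I) : ℝ) ≤ ((i + 1 : ℕ) : ℝ) / 2 ^ m := min_le_right _ _
    rw [e1]
    refine (sub_le_sub_right e2 _).trans (le_of_eq ?_)
    push_cast
    field_simp
    ring_nf
    rw [← mul_pow]
    norm_num
  rw [mzMeasure, Measure.smul_apply, Measure.add_apply, Measure.dirac_apply' _ hm,
    indicator_of_notMem h1, add_zero, smul_eq_mul]
  refine le_trans ?_ hvol
  calc _ ≤ 1 * (volume : Measure I) A := by gcongr; norm_num
    _ = _ := one_mul _

/-- Each grid cell before time 1 has mass at most `(1 / 2) ^ m`, and the increments telescope to at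
most 1. The atom at 1 contributes nothing because `ψ` is constant from `2 ^ m` on. -/
theorem lintegral_dyadic_increment_le {m : ℕ} {ψ : ℕ → ℝ} (hψ : Monotone ψ) (h0 : 0 ≤ ψ 0)
    (h1 : ψ (2 ^ m) ≤ 1) (hc : ∀ i, 2 ^ m ≤ i → ψ i = ψ (2 ^ m)) :
    ∫⁻ t : I, ENNReal.ofReal (ψ (⌊(t : ℝ) * 2 ^ m⌋₊ + 1) - ψ ⌊(t : ℝ) * 2 ^ m⌋₊) ∂mzMeasure ≤
      ENNReal.ofReal ((1 / 2) ^ m) := by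
  have hfl : Measurable fun t : I => ⌊(t : ℝ) * 2 ^ m⌋₊ := by fun_prop
  have hmap := lintegral_map (μ := mzMeasure)
    (measurable_from_top (f := fun i : ℕ => ENNReal.ofReal (ψ (i + 1) - ψ i))) hfl
  rw [← hmap, lintegral_countable', tsum_eq_sum (s := Finset.range (2 ^ m))]
  · calc ∑ i ∈ Finset.range (2 ^ m), ENNReal.ofReal (ψ (i + 1) - ψ i) *
          (mzMeasure.map fun t : I => ⌊(t : ℝ) * 2 ^ m⌋₊) {i}
        ≤ ∑ i ∈ Finset.range (2 ^ m), ENNReal.ofReal (ψ (i + 1) - ψ i) *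
          ENNReal.ofReal ((1 / 2) ^ m) := by
          refine Finset.sum_le_sum fun i hi => ?_
          gcongr
          rw [Measure.map_apply hfl (measurableSet_singleton i)]
          exact mzMeasure_floor_eq_le (Finset.mem_range.1 hi)
      _ = ENNReal.ofReal (ψ (2 ^ m) - ψ 0) * ENNReal.ofReal ((1 / 2) ^ m) := by
          rw [← Finset.sum_mul, ← ENNReal.ofReal_sum_of_nonneg, Finset.sum_range_sub]
          exact fun i _ => sub_nonneg.2 (hψ (Nat.le_succ i))
      _ ≤ 1 * ENNReal.ofReal ((1 / 2) ^ m) := by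
          gcongr
          exact ENNReal.ofReal_le_one.2 (by linarith)
      _ = _ := one_mul _
  · intro i hi
    have hi' : 2 ^ m ≤ i := by simpa using hi
    rw [hc i hi', hc (i + 1) (hi'.trans (Nat.le_succ i)), sub_self, ENNReal.ofReal_zero, zero_mul]

section Compactness

variable {X : Type*} [TopologicalSpace X]

theorem CadlagPath.measurable_uncurry [MetrizableSpace X] [SecondCountableTopology X]
    [MeasurableSpace X] [BorelSpace X] {Ω : Type*} [MeasurableSpace Ω] {Ψ : Ω → CadlagPath X}
    (hΨ : Measurable Ψ) : Measurable fun p : Ω × I => Ψ p.1 p.2 := by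
  refine measurable_of_tendsto_metrizable
    (f := fun n (p : Ω × I) => Ψ p.1 (nextDyadic n p.2)) (fun n => ?_)
    (tendsto_pi_nhds.2 fun p => (Ψ p.1).tendsto_nextDyadic p.2)
  have h1 : Measurable fun p : Ω × ℕ => Ψ p.1 (dyadicTime n p.2) :=
    measurable_from_prod_countable_left fun k =>
      (CadlagPath.measurable_eval (dyadicTime n k : I)).comp hΨ
  have h2 : Measurable fun p : Ω × I => (p.1, ⌊(p.2 : ℝ) * 2 ^ n⌋₊ + 1) := by fun_prop
  exact h1.comp h2

variable [MeasurableSpace X]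

/-- The laws on `X ^ DyadicTime` under which all `φ k` are martingales. -/
def cylinderLaws (φ : ℕ → C(X, I)) : Set (ProbabilityMeasure (DyadicTime → X)) :=
  {ν | ∀ k, IsCylinderMartingale (ν : Measure (DyadicTime → X)) (fun d q => q d) (φ k)}

variable [CompactSpace X] [MetrizableSpace X] [BorelSpace X] {φ : ℕ → C(X, I)}

/-- The ambient space of laws is compact, and each condition equates the integrals of two continuous
functions. This is the reason for testing martingales with continuous functions of finitely many
coordinates. -/
theorem isCompact_cylinderLaws (φ : ℕ → C(X, I)) : IsCompact (cylinderLaws φ) := by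
  refine IsClosed.isCompact ?_
  simp only [cylinderLaws, IsCylinderMartingale, ofPred_forall]
  refine isClosed_iInter fun k => isClosed_iInter fun s => isClosed_iInter fun t =>
    isClosed_iInter fun _ => isClosed_iInter fun κ => isClosed_iInter fun _ =>
    isClosed_iInter fun u => isClosed_iInter fun _ => isClosed_iInter fun g => ?_
  have hcont : ∀ r : DyadicTime, Continuous fun ν : ProbabilityMeasure (DyadicTime → X) =>
      ∫ q, (φ k (q r) : ℝ) * g (fun i => q (u i)) ∂(ν : Measure (DyadicTime → X)) := fun r =>
    ProbabilityMeasure.continuous_integral_continuousMap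
      (⟨fun q => (φ k (q r) : ℝ) * g (fun i => q (u i)), by fun_prop⟩ : C(DyadicTime → X, ℝ))
  exact isClosed_eq (hcont t) (hcont s)

variable {ν : ProbabilityMeasure (DyadicTime → X)}

theorem ae_mem_regularizable (hν : ν ∈ cylinderLaws φ) :
    ∀ᵐ q ∂(ν : Measure (DyadicTime → X)), q ∈ regularizable φ := by
  refine ae_all_iff.2 fun k => ae_all_iff.2 fun a => ae_all_iff.2 fun b => ae_all_iff.2 fun hab => ?_
  exact ae_liminf_dyadicUpcrossings_lt_top ((hν k).martingale fun d => measurable_pi_apply d)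
    (fun d q => abs_testFunction_le _ _) (by exact_mod_cast hab)

theorem integrable_of_continuous_of_compact {Y : Type*} [TopologicalSpace Y] [CompactSpace Y]
    [MeasurableSpace Y] [OpensMeasurableSpace Y] {μ : Measure Y} [IsFiniteMeasure μ] {f : Y → ℝ}
    (hf : Continuous f) : Integrable f μ :=
  (BoundedContinuousFunction.mkOfCompact ⟨f, hf⟩).integrable μ

/-- This is orthogonality of martingale increments, obtained by testing with the value of `φ k` at
the earlier time. -/
theorem integral_sq_sub_eq (hν : ν ∈ cylinderLaws φ) (k : ℕ) {u v : DyadicTime} (huv : u ≤ v) :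
    ∫ q, ((φ k (q v) : ℝ) - φ k (q u)) ^ 2 ∂(ν : Measure (DyadicTime → X)) =
      ∫ q, (φ k (q v) : ℝ) ^ 2 ∂(ν : Measure (DyadicTime → X)) -
        ∫ q, (φ k (q u) : ℝ) ^ 2 ∂(ν : Measure (DyadicTime → X)) := by
  have h := hν k u v huv Unit (fun _ => u) (fun _ => le_rfl)
    ⟨fun y => (φ k (y ()) : ℝ), by fun_prop⟩
  simp only [ContinuousMap.coe_mk] at h
  have e : ∀ q : DyadicTime → X, ((φ k (q v) : ℝ) - φ k (q u)) ^ 2 =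
      (φ k (q v) : ℝ) ^ 2 + (φ k (q u) : ℝ) * φ k (q u) - 2 * ((φ k (q v) : ℝ) * φ k (q u)) :=
    fun q => by ring
  simp_rw [e]
  rw [integral_sub, integral_add, integral_const_mul, h]
  · simp_rw [← sq]
    ring
  all_goals exact integrable_of_continuous_of_compact (by fun_prop)

theorem integral_sq_mono (hν : ν ∈ cylinderLaws φ) (k : ℕ) {u v : DyadicTime} (huv : u ≤ v) :
    ∫ q, (φ k (q u) : ℝ) ^ 2 ∂(ν : Measure (DyadicTime → X)) ≤
      ∫ q, (φ k (q v) : ℝ) ^ 2 ∂(ν : Measure (DyadicTime → X)) := by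
  rw [← sub_nonneg, ← integral_sq_sub_eq hν k huv]
  exact integral_nonneg fun q => sq_nonneg _

theorem integral_sq_regularize_sub_le (hφ : ∀ x y, (∀ k, φ k x = φ k y) → x = y)
    (hν : ν ∈ cylinderLaws φ) (k m : ℕ) (t : I) :
    ∫ q, ((φ k (regularize hφ q t) : ℝ) - φ k (q (nextDyadic m t))) ^ 2
        ∂(ν : Measure (DyadicTime → X)) ≤
      ∫ q, (φ k (q (nextDyadic m t)) : ℝ) ^ 2 ∂(ν : Measure (DyadicTime → X)) -
        ∫ q, (φ k (q (dyadicTime m ⌊(t : ℝ) * 2 ^ m⌋₊)) : ℝ) ^ 2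
          ∂(ν : Measure (DyadicTime → X)) := by
  have hlim : Tendsto (fun j => ∫ q, ((φ k (q (nextDyadic j t)) : ℝ) -
      φ k (q (nextDyadic m t))) ^ 2 ∂(ν : Measure (DyadicTime → X))) atTop
      (𝓝 (∫ q, ((φ k (regularize hφ q t) : ℝ) - φ k (q (nextDyadic m t))) ^ 2
        ∂(ν : Measure (DyadicTime → X)))) := by
    refine tendsto_integral_of_dominated_convergence (fun _ => 1) (fun j => ?_)
      (integrable_const _) (fun j => .of_forall fun q => ?_) ?_
    · exact (by fun_prop : Continuous fun q : DyadicTime → X => ((φ k (q (nextDyadic j t)) : ℝ) -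
        φ k (q (nextDyadic m t))) ^ 2).aestronglyMeasurable
    · rw [Real.norm_of_nonneg (sq_nonneg _)]
      exact sq_sub_testFunction_le _ _ _
    · filter_upwards [ae_mem_regularizable hν] with q hq
      have h1 : Tendsto (fun n => (φ k (q (nextDyadic n t)) : ℝ)) atTop
          (𝓝 (φ k (regularize hφ q t) : ℝ)) :=
        ((by fun_prop : Continuous fun x => (φ k x : ℝ)).tendsto _).comp
          (tendsto_regularize hφ hq t)
      exact (h1.sub_const _).pow 2
  -- Finer approximations from the right eventually lie below the coarse one, which puts the two
  -- times in the order that orthogonality of increments needs.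
  have hev : ∀ᶠ j in atTop, nextDyadic j t ≤ nextDyadic m t := by
    rcases eq_or_lt_of_le (show t ≤ 1 from t.2.2) with rfl | ht
    · exact .of_forall fun j => by rw [nextDyadic_one_eq, nextDyadic_one_eq]
    · have h1 : Tendsto (fun n => (nextDyadic n t : I)) atTop (𝓝 t) :=
        (tendsto_nextDyadic t).mono_right nhdsWithin_le_nhds
      filter_upwards [h1.eventually_lt_const (lt_nextDyadic m ht)] with j hj using hj.le
  refine le_of_tendsto hlim ?_
  filter_upwards [hev] with j hj
  have : ∀ q : DyadicTime → X, ((φ k (q (nextDyadic j t)) : ℝ) - φ k (q (nextDyadic m t))) ^ 2 =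
      ((φ k (q (nextDyadic m t)) : ℝ) - φ k (q (nextDyadic j t))) ^ 2 := fun q => by ring
  simp_rw [this]
  rw [integral_sq_sub_eq hν k hj]
  -- Second moments increase in time. Replacing the subtracted one by its value at the grid point at
  -- or before `t` gives a bound independent of `j` that telescopes over the cells.
  have h2 : dyadicTime m ⌊(t : ℝ) * 2 ^ m⌋₊ ≤ nextDyadic j t :=
    (dyadicTime_floor_le m t).trans (le_nextDyadic j t)
  exact sub_le_sub_left (integral_sq_mono hν k h2) _

/-- After exchanging the integrals, the error at time `t` is at most an increment of the second
moment over the grid cell of `t`. The bound is uniform over all cylinder laws. -/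
theorem lintegral_sq_regularize_sub_le (hφ : ∀ x y, (∀ k, φ k x = φ k y) → x = y)
    (hν : ν ∈ cylinderLaws φ) (k m : ℕ) :
    ∫⁻ q, ∫⁻ t, ENNReal.ofReal (((φ k (regularize hφ q t) : ℝ) - φ k (q (nextDyadic m t))) ^ 2)
        ∂mzMeasure ∂(ν : Measure (DyadicTime → X)) ≤ ENNReal.ofReal ((1 / 2) ^ m) := by
  have hφc : Continuous fun x => (φ k x : ℝ) := by fun_prop
  have h1 : Measurable fun p : (DyadicTime → X) × I => (φ k (regularize hφ p.1 p.2) : ℝ) :=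
    hφc.measurable.comp (CadlagPath.measurable_uncurry (measurable_regularize hφ))
  have h2 : Measurable fun p : (DyadicTime → X) × I => (φ k (p.1 (nextDyadic m p.2)) : ℝ) :=
    hφc.measurable.comp (CadlagPath.measurable_uncurry (CadlagPath.continuous_ofDyadic m).measurable)
  rw [lintegral_lintegral_swap ((h1.sub h2).pow_const 2).ennreal_ofReal.aemeasurable]
  set ψ : ℕ → ℝ := fun i =>
    ∫ q, (φ k (q (dyadicTime m i)) : ℝ) ^ 2 ∂(ν : Measure (DyadicTime → X)) with hψ
  refine le_trans ?_ (lintegral_dyadic_increment_le (m := m) (ψ := ψ) (fun i j hij => ?_) ?_ ?_ ?_)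
  · refine lintegral_mono fun t => ?_
    have hint : Integrable (fun q : DyadicTime → X =>
        ((φ k (regularize hφ q t) : ℝ) - φ k (q (nextDyadic m t))) ^ 2) (ν : Measure _) := by
      refine .of_bound (C := 1) ?_ (.of_forall fun q => ?_)
      · exact (((h1.comp measurable_prodMk_right).sub
          (h2.comp measurable_prodMk_right)).pow_const 2).aestronglyMeasurable
      · rw [Real.norm_of_nonneg (sq_nonneg _)]
        exact sq_sub_testFunction_le _ _ _
    rw [← ofReal_integral_eq_lintegral_ofReal hint (.of_forall fun q => sq_nonneg _)]
    exact ENNReal.ofReal_le_ofReal (integral_sq_regularize_sub_le hφ hν k m t)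
  · exact integral_sq_mono hν k (dyadicTime_mono m hij)
  · exact integral_nonneg fun q => sq_nonneg _
  · calc ψ (2 ^ m) ≤ ∫ _, (1 : ℝ) ∂(ν : Measure (DyadicTime → X)) :=
          integral_mono_of_nonneg (.of_forall fun q => sq_nonneg _) (integrable_const _)
            (.of_forall fun q => pow_le_one₀ (φ k _).2.1 (φ k _).2.2)
      _ = 1 := by simp
  · intro i hi
    have : dyadicTime m i = dyadicTime m (2 ^ m) :=
      Subtype.ext ((dyadicTime_of_le hi).trans (dyadicTime_of_le le_rfl).symm)
    simp only [hψ, this]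

end Compactness

/-! ### Compactness of the set of martingale laws on `D(X)` -/

/-- Away from the diagonal, compactness makes a finite sum of squared differences bounded below.
There the distance is at most the diameter, hence at most a multiple of that sum. -/
theorem exists_edist_le_add_sum_sq {X : Type*} [MetricSpace X] [CompactSpace X] {φ : ℕ → C(X, I)}
    (hφ : ∀ x y, (∀ k, φ k x = φ k y) → x = y) {ε : ℝ≥0∞} (hε : 0 < ε) :
    ∃ (N : ℕ) (C : ℝ≥0∞), C ≠ ⊤ ∧ ∀ x y : X, edist x y ≤
      ε + C * ∑ k ∈ Finset.range N, ENNReal.ofReal (((φ k x : ℝ) - φ k y) ^ 2) := by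
  let T : ℕ → X × X → ℝ := fun N p => ∑ k ∈ Finset.range N, ((φ k p.1 : ℝ) - φ k p.2) ^ 2
  have hT : ∀ N, Continuous (T N) := fun N => by fun_prop
  have hTmono : ∀ p, Monotone fun N => T N p := fun p M N h =>
    Finset.sum_le_sum_of_subset_of_nonneg (Finset.range_mono h) fun _ _ _ => sq_nonneg _
  have hK : IsCompact {p : X × X | ε ≤ edist p.1 p.2} :=
    (isClosed_le continuous_const (by fun_prop)).isCompact
  obtain ⟨N, hN⟩ := hK.elim_directed_cover (fun N : ℕ => {p | 1 / ((N : ℝ) + 1) < T N p})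
    (fun N => isOpen_lt continuous_const (hT N)) (fun p hp => by
      have hne : p.1 ≠ p.2 := fun h => by
        have hp' : ε ≤ edist p.1 p.2 := hp
        rw [h, edist_self] at hp'
        exact absurd hp' (not_le.2 hε)
      obtain ⟨k, hk⟩ : ∃ k, φ k p.1 ≠ φ k p.2 := by
        by_contra! hc
        exact hne (hφ _ _ hc)
      have hpos : 0 < T (k + 1) p := by
        refine lt_of_lt_of_le ?_ (Finset.single_le_sum (fun _ _ => sq_nonneg _)
          (Finset.self_mem_range_succ k))
        have : (φ k p.1 : ℝ) - φ k p.2 ≠ 0 := sub_ne_zero.2 fun h => hk (Subtype.ext h)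
        positivity
      obtain ⟨n, hn⟩ := exists_nat_one_div_lt hpos
      refine mem_iUnion.2 ⟨max n (k + 1), ?_⟩
      refine lt_of_le_of_lt ?_ (hn.trans_le (hTmono p (le_max_right _ _)))
      gcongr
      exact le_max_left _ _)
    (directed_of_isDirected_le fun M N h p hp => by
      have hp' : 1 / ((M : ℝ) + 1) < T M p := hp
      refine lt_of_le_of_lt ?_ (hp'.trans_le (hTmono p h))
      gcongr)
  -- The cover gives the lower bound `1 / (N + 1)` for the sum, so this constant turns the sum into
  -- at least the diameter.
  refine ⟨N, Metric.ediam (univ : Set X) * ((N : ℝ≥0∞) + 1), ?_, fun x y => ?_⟩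
  · refine ENNReal.mul_ne_top ?_ (by simp)
    exact isCompact_univ.isBounded.ediam_ne_top
  · rcases lt_or_ge (edist x y) ε with h | h
    · exact h.le.trans le_self_add
    · have h1 : 1 / ((N : ℝ) + 1) < T N (x, y) := hN (show (x, y) ∈ {p : X × X | _} from h)
      have h2 : 1 ≤ ((N : ℝ≥0∞) + 1) *
          ∑ k ∈ Finset.range N, ENNReal.ofReal (((φ k x : ℝ) - φ k y) ^ 2) := by
        rw [← ENNReal.ofReal_sum_of_nonneg fun _ _ => sq_nonneg _]
        have e : ((N : ℝ≥0∞) + 1) = ENNReal.ofReal ((N : ℝ) + 1) := by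
          rw [ENNReal.ofReal_add (by positivity) zero_le_one, ENNReal.ofReal_natCast,
            ENNReal.ofReal_one]
        rw [e, ← ENNReal.ofReal_mul (by positivity), ENNReal.one_le_ofReal]
        have := (div_lt_iff₀ (by positivity : (0 : ℝ) < (N : ℝ) + 1)).1 h1
        linarith
      calc edist x y ≤ Metric.ediam (univ : Set X) * 1 := by
            rw [mul_one]
            exact Metric.edist_le_ediam_of_mem (mem_univ x) (mem_univ y)
        _ ≤ Metric.ediam (univ : Set X) * (((N : ℝ≥0∞) + 1) *
            ∑ k ∈ Finset.range N, ENNReal.ofReal (((φ k x : ℝ) - φ k y) ^ 2)) := by gcongr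
        _ ≤ _ := by rw [← mul_assoc]; exact le_add_self

/-- Markov's inequality bounds the measure of the times where the distance is at least `η`. -/
theorem CadlagPath.kyFan_edist_le {X : Type*} [MetricSpace X] (f g : CadlagPath X) {η : ℝ≥0∞}
    (h0 : η ≠ 0) (ht : η ≠ ⊤) :
    (kyFan X).edist f g ≤ η + η⁻¹ * ∫⁻ t, edist (f t) (g t) ∂mzMeasure := by
  refine sInf_le ?_
  have hm : AEMeasurable (fun t => edist (f t) (g t)) mzMeasure :=
    (f.stronglyMeasurable.edist g.stronglyMeasurable).aemeasurable
  calc mzMeasure {t | η + η⁻¹ * ∫⁻ t, edist (f t) (g t) ∂mzMeasure < edist (f t) (g t)}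
      ≤ mzMeasure {t | η ≤ edist (f t) (g t)} :=
        measure_mono fun t (h : _ < _) => (le_self_add.trans h.le : η ≤ _)
    _ ≤ (∫⁻ t, edist (f t) (g t) ∂mzMeasure) / η := meas_ge_le_lintegral_div hm h0 ht
    _ = η⁻¹ * ∫⁻ t, edist (f t) (g t) ∂mzMeasure := by rw [div_eq_mul_inv, mul_comm]
    _ ≤ _ := le_add_self

theorem CadlagPath.kyFan_edist_le_sum {X : Type*} [MetricSpace X] {φ : ℕ → C(X, I)}
    {η : ℝ≥0∞} (h0 : η ≠ 0) (ht : η ≠ ⊤) {N : ℕ} {C ε : ℝ≥0∞} (hC : C ≠ ⊤)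
    (hNC : ∀ x y : X, edist x y ≤
      ε + C * ∑ k ∈ Finset.range N, ENNReal.ofReal (((φ k x : ℝ) - φ k y) ^ 2))
    (f g : CadlagPath X) :
    (kyFan X).edist f g ≤ η + η⁻¹ * (ε + C * ∑ k ∈ Finset.range N,
      ∫⁻ t, ENNReal.ofReal (((φ k (f t) : ℝ) - φ k (g t)) ^ 2) ∂mzMeasure) := by
  have hm : ∀ (k : ℕ) (f : CadlagPath X), Measurable fun t => (φ k (f t) : ℝ) := fun k f =>
    ((by fun_prop : Continuous fun x => (φ k x : ℝ)).comp_stronglyMeasurable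
      f.stronglyMeasurable).measurable
  have hq : ∀ k, Measurable fun t : I =>
      ENNReal.ofReal (((φ k (f t) : ℝ) - φ k (g t)) ^ 2) := fun k =>
    (((hm k f).sub (hm k g)).pow_const 2).ennreal_ofReal
  refine (kyFan_edist_le f g h0 ht).trans ?_
  gcongr
  calc ∫⁻ t, edist (f t) (g t) ∂mzMeasure
      ≤ ∫⁻ t, (ε + C * ∑ k ∈ Finset.range N,
          ENNReal.ofReal (((φ k (f t) : ℝ) - φ k (g t)) ^ 2)) ∂mzMeasure :=
        lintegral_mono fun t => hNC _ _
    _ = _ := by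
        rw [lintegral_add_left measurable_const, lintegral_const, measure_univ, mul_one,
          lintegral_const_mul' _ _ hC, lintegral_finsetSum _ fun k _ => hq k]

theorem CadlagPath.tendsto_of_forall_lipschitz_kyFan {X : Type*} [TopologicalSpace X]
    [MetrizableSpace X] {ι : Type*} {L : Filter ι} [L.IsCountablyGenerated]
    {μs : ι → ProbabilityMeasure (CadlagPath X)} {μ : ProbabilityMeasure (CadlagPath X)}
    (h : letI := metrizableSpaceMetric X
      ∀ f : CadlagPath X → ℝ, (∃ C : ℝ, ∀ x y, dist (f x) (f y) ≤ C) →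
        (∃ K, @LipschitzWith _ _ (CadlagPath.kyFan X) _ K f) →
        Tendsto (fun i => ∫ z, f z ∂(μs i : Measure (CadlagPath X))) L
          (𝓝 (∫ z, f z ∂(μ : Measure (CadlagPath X))))) :
    Tendsto μs L (𝓝 μ) := by
  let _ := metrizableSpaceMetric X
  exact (@tendsto_iff_forall_lipschitz_integral_tendsto _ _ _ (CadlagPath.kyFan X)
    (inferInstanceAs (OpensMeasurableSpace (CadlagPath X))) L _ μs μ).2 h

section Compactness

variable {X : Type*} [TopologicalSpace X] [CompactSpace X] [MetrizableSpace X] [MeasurableSpace X]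
  [BorelSpace X] {φ : ℕ → C(X, I)}

theorem exists_forall_lintegral_kyFan_le (hφ : ∀ x y, (∀ k, φ k x = φ k y) → x = y)
    {δ : ℝ≥0∞} (hδ : δ ≠ 0) (hδt : δ ≠ ⊤) :
    letI := metrizableSpaceMetric X
    ∃ m, ∀ ν ∈ cylinderLaws φ, ∫⁻ q, (CadlagPath.kyFan X).edist (regularize hφ q)
      (CadlagPath.ofDyadic m q) ∂(ν : Measure (DyadicTime → X)) ≤ δ := by
  let _ := metrizableSpaceMetric X
  -- One third is the Markov threshold, one third is `η⁻¹ * (η * η)`, and one third bounds the sum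
  -- of square errors for large `m`.
  set η := δ / 3 with hη
  have hη0 : η ≠ 0 := (ENNReal.div_pos hδ (by norm_num)).ne'
  have hηt : η ≠ ⊤ := ENNReal.div_ne_top hδt (by norm_num)
  obtain ⟨N, C, hC, hNC⟩ := exists_edist_le_add_sum_sq hφ (ε := η * η)
    (pos_iff_ne_zero.2 (mul_ne_zero hη0 hη0))
  have hlim : Tendsto (fun m : ℕ => η⁻¹ * (C * (N * ENNReal.ofReal ((1 / 2 : ℝ) ^ m)))) atTop
      (𝓝 0) := by
    have h1 : Tendsto (fun m : ℕ => ENNReal.ofReal ((1 / 2 : ℝ) ^ m)) atTop (𝓝 0) := by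
      rw [← ENNReal.ofReal_zero]
      exact ENNReal.tendsto_ofReal
        (tendsto_pow_atTop_nhds_zero_of_lt_one (by norm_num) (by norm_num))
    have h2 := ENNReal.Tendsto.const_mul h1 (.inr (ENNReal.natCast_ne_top N))
    have h3 := ENNReal.Tendsto.const_mul h2 (.inr hC)
    have h4 := ENNReal.Tendsto.const_mul h3 (.inr (ENNReal.inv_ne_top.2 hη0))
    simpa using h4
  obtain ⟨m, hm⟩ := (hlim.eventually_le_const (pos_iff_ne_zero.2 hη0)).exists
  refine ⟨m, fun ν hν => ?_⟩
  let A : (DyadicTime → X) → ℕ → ℝ≥0∞ := fun q k =>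
    ∫⁻ t, ENNReal.ofReal (((φ k (regularize hφ q t) : ℝ) - φ k (q (nextDyadic m t))) ^ 2) ∂mzMeasure
  have hmeas : ∀ k, Measurable fun p : (DyadicTime → X) × I =>
      ENNReal.ofReal (((φ k (regularize hφ p.1 p.2) : ℝ) - φ k (p.1 (nextDyadic m p.2))) ^ 2) := by
    intro k
    have hφc : Continuous fun x => (φ k x : ℝ) := by fun_prop
    exact (((hφc.measurable.comp (CadlagPath.measurable_uncurry (measurable_regularize hφ))).sub
      (hφc.measurable.comp (CadlagPath.measurable_uncurry
        (CadlagPath.continuous_ofDyadic m).measurable))).pow_const 2).ennreal_ofReal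
  have hA : ∀ k, Measurable fun q => A q k := fun k => (hmeas k).lintegral_prod_right'
  have hpt : ∀ q, (CadlagPath.kyFan X).edist (regularize hφ q) (CadlagPath.ofDyadic m q) ≤
      η + η⁻¹ * (η * η + C * ∑ k ∈ Finset.range N, A q k) := by
    exact fun q => CadlagPath.kyFan_edist_le_sum hη0 hηt hC hNC _ _
  calc ∫⁻ q, (CadlagPath.kyFan X).edist (regularize hφ q) (CadlagPath.ofDyadic m q)
        ∂(ν : Measure (DyadicTime → X))
      ≤ ∫⁻ q, (η + η⁻¹ * (η * η + C * ∑ k ∈ Finset.range N, A q k))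
          ∂(ν : Measure (DyadicTime → X)) := lintegral_mono hpt
    _ = η + η⁻¹ * (η * η + C * ∑ k ∈ Finset.range N, ∫⁻ q, A q k
          ∂(ν : Measure (DyadicTime → X))) := by
        have hs : Measurable fun q => ∑ k ∈ Finset.range N, A q k :=
          Finset.measurable_fun_sum _ fun k _ => hA k
        rw [lintegral_add_left measurable_const, lintegral_const, measure_univ, mul_one,
          lintegral_const_mul _ (by fun_prop), lintegral_add_left measurable_const,
          lintegral_const, measure_univ, mul_one, lintegral_const_mul _ hs,
          lintegral_finsetSum _ fun k _ => hA k]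
    _ ≤ η + η⁻¹ * (η * η + C * ∑ k ∈ Finset.range N, ENNReal.ofReal ((1 / 2) ^ m)) := by
        gcongr with k
        exact lintegral_sq_regularize_sub_le hφ hν k m
    _ = η + (η + η⁻¹ * (C * (N * ENNReal.ofReal ((1 / 2 : ℝ) ^ m)))) := by
        rw [Finset.sum_const, Finset.card_range, nsmul_eq_mul, mul_add, ← mul_assoc η⁻¹ η η,
          ENNReal.inv_mul_cancel hη0 hηt, one_mul]
    _ ≤ η + (η + η) := by gcongr
    _ = δ := by
        rw [← add_assoc, hη]
        exact ENNReal.add_thirds δ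

/-- The law of the regularization. -/
noncomputable def regularizedLaw (hφ : ∀ x y, (∀ k, φ k x = φ k y) → x = y)
    (ν : ProbabilityMeasure (DyadicTime → X)) : ProbabilityMeasure (CadlagPath X) :=
  ν.map (measurable_regularize hφ).aemeasurable

/-- Against a bounded Lipschitz function, `regularize` may be replaced by the continuous map
`CadlagPath.ofDyadic m`, with an error that is small uniformly on `cylinderLaws φ`. A uniform limit
of continuous functions is continuous. -/
theorem continuousOn_regularizedLaw (hφ : ∀ x y, (∀ k, φ k x = φ k y) → x = y) :
    ContinuousOn (regularizedLaw hφ) (cylinderLaws φ) := by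
  intro ν hν
  let _ := metrizableSpaceMetric X
  refine CadlagPath.tendsto_of_forall_lipschitz_kyFan fun f ⟨B, hB⟩ ⟨K, hK⟩ => ?_
  have hfc : Continuous f := @LipschitzWith.continuous _ _ (CadlagPath.kyFan X) _ _ _ hK
  have hmapint : ∀ ν : ProbabilityMeasure (DyadicTime → X),
      ∫ z, f z ∂(regularizedLaw hφ ν : Measure (CadlagPath X)) =
        ∫ q, f (regularize hφ q) ∂(ν : Measure (DyadicTime → X)) := fun ν =>
    integral_map (measurable_regularize hφ).aemeasurable hfc.aestronglyMeasurable
  simp_rw [hmapint]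
  refine (continuousOn_of_uniform_approx_of_continuousOn (s := cylinderLaws φ) fun u hu => ?_) ν hν
  obtain ⟨ε, hε, hεu⟩ := Metric.mem_uniformity_dist.1 hu
  -- Dividing by `K + 1` avoids a separate case for `K = 0`.
  have hK1 : (0 : ℝ) < (K : ℝ) + 1 := by positivity
  obtain ⟨m, hm⟩ := exists_forall_lintegral_kyFan_le hφ
    (δ := ENNReal.ofReal (ε / 2 / ((K : ℝ) + 1))) (by simp; positivity) ENNReal.ofReal_ne_top
  have hcm : Continuous fun q : DyadicTime → X => f (CadlagPath.ofDyadic m q) :=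
    hfc.comp (CadlagPath.continuous_ofDyadic m)
  refine ⟨fun ν => ∫ q, f (CadlagPath.ofDyadic m q) ∂(ν : Measure (DyadicTime → X)),
    Continuous.continuousOn (ProbabilityMeasure.continuous_integral_continuousMap
      (⟨_, hcm⟩ : C(DyadicTime → X, ℝ))), fun ρ hρ => hεu ?_⟩
  have hi2 : Integrable (fun q => f (CadlagPath.ofDyadic m q)) (ρ : Measure (DyadicTime → X)) :=
    integrable_of_continuous_of_compact hcm
  have hdm : AEStronglyMeasurable (fun q => f (regularize hφ q) - f (CadlagPath.ofDyadic m q))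
      (ρ : Measure (DyadicTime → X)) :=
    ((hfc.measurable.comp (measurable_regularize hφ)).sub hcm.measurable).aestronglyMeasurable
  have hid : Integrable (fun q => f (regularize hφ q) - f (CadlagPath.ofDyadic m q))
      (ρ : Measure (DyadicTime → X)) := .of_bound hdm B (.of_forall fun q => by
    rw [← dist_eq_norm]; exact hB _ _)
  have hi1 : Integrable (fun q => f (regularize hφ q)) (ρ : Measure (DyadicTime → X)) :=
    (hid.add hi2).congr (.of_forall fun q => sub_add_cancel _ _)
  rw [dist_eq_norm, ← integral_sub hi1 hi2]
  refine lt_of_le_of_lt (norm_integral_le_lintegral_norm _) ?_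
  have hle : ∫⁻ q, ENNReal.ofReal ‖f (regularize hφ q) - f (CadlagPath.ofDyadic m q)‖
      ∂(ρ : Measure (DyadicTime → X)) ≤ ENNReal.ofReal (ε / 2) := by
    calc _ ≤ ∫⁻ q, (K : ℝ≥0∞) * (CadlagPath.kyFan X).edist (regularize hφ q)
          (CadlagPath.ofDyadic m q) ∂(ρ : Measure (DyadicTime → X)) := by
          refine lintegral_mono fun q => ?_
          rw [← dist_eq_norm, ← edist_dist]
          exact hK _ _
      _ = K * ∫⁻ q, (CadlagPath.kyFan X).edist (regularize hφ q)
          (CadlagPath.ofDyadic m q) ∂(ρ : Measure (DyadicTime → X)) :=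
          lintegral_const_mul' _ _ ENNReal.coe_ne_top
      _ ≤ ENNReal.ofReal ((K : ℝ) + 1) * ENNReal.ofReal (ε / 2 / ((K : ℝ) + 1)) := by
          gcongr
          · rw [← ENNReal.ofReal_coe_nnreal]
            exact ENNReal.ofReal_le_ofReal (by linarith)
          · exact hm ρ hρ
      _ = _ := by
          rw [← ENNReal.ofReal_mul hK1.le]
          congr 1
          field_simp
  calc _ ≤ ε / 2 := ENNReal.toReal_le_of_le_ofReal (by positivity) hle
    _ < ε := by linarith

/-- The identity holds at the approximating dyadic times, whose order is preserved since `nextDyadic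
n` is monotone. It passes to the limit by dominated convergence. -/
theorem isCylinderMartingale_regularizedLaw (hφ : ∀ x y, (∀ k, φ k x = φ k y) → x = y)
    {ν : ProbabilityMeasure (DyadicTime → X)} (hν : ν ∈ cylinderLaws φ) (k : ℕ) :
    IsCylinderMartingale (regularizedLaw hφ ν : Measure (CadlagPath X)) (fun t z => z t)
      (φ k) := by
  intro s t hst κ _ u hu g
  have hφc : Continuous fun x => (φ k x : ℝ) := by fun_prop
  have hmeas : ∀ r : I, Measurable fun z : CadlagPath X =>
      (φ k (z r) : ℝ) * g (fun i => z (u i)) := fun r =>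
    (hφc.measurable.comp (CadlagPath.measurable_eval r)).mul
      (g.continuous.measurable.comp (measurable_pi_lambda _ fun i => CadlagPath.measurable_eval _))
  obtain ⟨C, hC⟩ := isCompact_univ.exists_bound_of_continuousOn g.continuous.continuousOn
  have hlim : ∀ r : I, Tendsto (fun n => ∫ q : DyadicTime → X, (φ k (q (nextDyadic n r)) : ℝ) *
      g (fun i => q (nextDyadic n (u i))) ∂(ν : Measure (DyadicTime → X))) atTop
      (𝓝 (∫ z, (φ k (z r) : ℝ) * g (fun i => z (u i))
        ∂(regularizedLaw hφ ν : Measure (CadlagPath X)))) := by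
    intro r
    have e : ∫ z, (φ k (z r) : ℝ) * g (fun i => z (u i))
        ∂(regularizedLaw hφ ν : Measure (CadlagPath X)) =
        ∫ q, (φ k (regularize hφ q r) : ℝ) * g (fun i => regularize hφ q (u i))
          ∂(ν : Measure (DyadicTime → X)) :=
      integral_map (measurable_regularize hφ).aemeasurable (hmeas r).aestronglyMeasurable
    rw [e]
    refine tendsto_integral_of_dominated_convergence (fun _ => C) (fun n => ?_)
      (integrable_const _) (fun n => .of_forall fun q => ?_) ?_
    · exact (by fun_prop : Continuous fun q : DyadicTime → X => (φ k (q (nextDyadic n r)) : ℝ) *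
        g (fun i => q (nextDyadic n (u i)))).aestronglyMeasurable
    · rw [norm_mul]
      calc _ ≤ 1 * ‖g fun i => q (nextDyadic n (u i))‖ := by
            gcongr
            exact abs_testFunction_le _ _
        _ ≤ C := by rw [one_mul]; exact hC _ (mem_univ _)
    · filter_upwards [ae_mem_regularizable hν] with q hq
      refine ((hφc.tendsto _).comp (tendsto_regularize hφ hq r)).mul ?_
      exact (g.continuous.tendsto _).comp
        (tendsto_pi_nhds.2 fun i => tendsto_regularize hφ hq (u i))
  refine tendsto_nhds_unique (hlim t) ((hlim s).congr fun n => ?_)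
  exact (hν k (nextDyadic n s) (nextDyadic n t) (nextDyadic_mono n hst) κ
    (fun i => nextDyadic n (u i)) (fun i => nextDyadic_mono n (hu i)) g).symm

/-- The set is the image of the compact set `cylinderLaws φ` under `regularizedLaw`. Surjectivity
holds because restricting a càdlàg path to dyadic times and regularizing recovers it almost surely.
-/
theorem isCompact_cylinderMartingaleLaws (hφ : ∀ x y, (∀ k, φ k x = φ k y) → x = y) :
    IsCompact {μ : ProbabilityMeasure (CadlagPath X) | ∀ k,
      IsCylinderMartingale (μ : Measure (CadlagPath X)) (fun t z => z t) (φ k)} := by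
  convert (isCompact_cylinderLaws φ).image_of_continuousOn (continuousOn_regularizedLaw hφ)
  refine Subset.antisymm (fun μ hμ => ?_) ?_
  · have hr : Measurable (CadlagPath.restrictDyadic (X := X)) :=
      measurable_pi_lambda _ fun d => CadlagPath.measurable_eval (d : I)
    have hν : μ.map hr.aemeasurable ∈ cylinderLaws φ := by
      intro k s t hst κ _ u hu g
      have e : ∀ r : DyadicTime, ∫ q, (φ k (q r) : ℝ) * g (fun i => q (u i))
          ∂(μ.map hr.aemeasurable : Measure (DyadicTime → X)) =
          ∫ z, (φ k (z r) : ℝ) * g (fun i => z (u i)) ∂(μ : Measure (CadlagPath X)) := fun r =>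
        integral_map hr.aemeasurable (by fun_prop : Continuous fun q : DyadicTime → X =>
          (φ k (q r) : ℝ) * g (fun i => q (u i))).aestronglyMeasurable
      rw [e, e]
      exact hμ k s t hst κ (fun i => (u i : I)) hu g
    refine ⟨_, hν, Subtype.ext ?_⟩
    change ((μ : Measure (CadlagPath X)).map CadlagPath.restrictDyadic).map (regularize hφ) = μ
    have hae := ae_of_ae_map hr.aemeasurable (ae_mem_regularizable hν)
    rw [Measure.map_map (measurable_regularize hφ) hr]
    conv_rhs => rw [← Measure.map_id (μ := (μ : Measure (CadlagPath X)))]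
    refine Measure.map_congr ?_
    filter_upwards [hae] with z hz using regularize_restrictDyadic hφ hz
  · rintro _ ⟨ν, hν, rfl⟩ k
    exact isCylinderMartingale_regularizedLaw hφ hν k

end Compactness

/-! ### Conditional expectations of random measures -/

theorem measurable_probabilityMeasure_apply {S : Type*} [MeasurableSpace S] {B : Set S}
    (hB : MeasurableSet B) : Measurable fun q : ProbabilityMeasure S => (q : Measure S) B :=
  (Measure.measurable_coe hB).comp measurable_subtype_coe

theorem Measurable.coe_probabilityMeasure {Ω S : Type*} [MeasurableSpace Ω] [MeasurableSpace S]
    {Z : Ω → ProbabilityMeasure S} (hZ : Measurable Z) : Measurable fun ω => (Z ω : Measure S) :=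
  measurable_subtype_coe.comp hZ

open scoped ProbabilityTheory in
theorem integral_integral_eq_integral_bind {Ω S : Type*} [MeasurableSpace Ω] [MeasurableSpace S]
    {P : Measure Ω} [IsFiniteMeasure P] {Z : Ω → ProbabilityMeasure S} (hZ : Measurable Z)
    {f : S → ℝ} (hf : Measurable f) {C : ℝ} (hC : ∀ x, |f x| ≤ C) :
    ∫ ω, ∫ x, f x ∂(Z ω : Measure S) ∂P = ∫ x, f x ∂(P.bind fun ω => (Z ω : Measure S)) := by
  let κ : ProbabilityTheory.Kernel Ω S := ⟨fun ω => (Z ω : Measure S),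
    measurable_subtype_coe.comp hZ⟩
  have : ProbabilityTheory.IsMarkovKernel κ :=
    ⟨fun ω => inferInstanceAs (IsProbabilityMeasure (Z ω : Measure S))⟩
  have hint : Integrable f ((κ ∘ₖ ProbabilityTheory.Kernel.const Unit P) ()) :=
    .of_bound hf.aestronglyMeasurable C (.of_forall fun x => hC x)
  have h := ProbabilityTheory.Kernel.integral_comp hint
  rw [ProbabilityTheory.Kernel.comp_apply, ProbabilityTheory.Kernel.const_apply] at h
  exact h.symm

theorem abs_integral_probabilityMeasure_le {S : Type*} [MeasurableSpace S]
    (q : ProbabilityMeasure S) {f : S → ℝ} {C : ℝ} (hC : ∀ x, |f x| ≤ C) :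
    |∫ x, f x ∂(q : Measure S)| ≤ C := by
  simpa using norm_integral_le_of_norm_le_const (μ := (q : Measure S)) (f := f)
    (.of_forall fun x => hC x)

section CondExp

variable {S : Type u} [MeasurableSpace S]
  {Ω : Type*} {m m₀ : MeasurableSpace Ω} {P : Measure Ω} [IsProbabilityMeasure P]
  {Z W : Ω → ProbabilityMeasure S}

theorem setLIntegral_measure_eq_ofReal (hZ : Measurable Z) {B : Set S} (hB : MeasurableSet B)
    (A : Set Ω) : ∫⁻ ω in A, (Z ω : Measure S) B ∂P =
      ENNReal.ofReal (∫ ω in A, ∫ x, B.indicator (fun _ => (1 : ℝ)) x ∂(Z ω : Measure S) ∂P) := by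
  have h1 : ∀ ω, ∫ x, B.indicator (fun _ => (1 : ℝ)) x ∂(Z ω : Measure S) =
      ((Z ω : Measure S) B).toReal := fun ω => by
    rw [integral_indicator_const _ hB, smul_eq_mul, mul_one]
    rfl
  have hm := ((measurable_probabilityMeasure_apply hB).comp hZ).ennreal_toReal
  simp_rw [h1]
  rw [ofReal_integral_eq_lintegral_ofReal]
  · exact lintegral_congr fun ω => (ENNReal.ofReal_toReal (measure_ne_top _ _)).symm
  · refine .of_bound (C := 1) hm.aestronglyMeasurable (.of_forall fun ω => ?_)
    rw [Real.norm_of_nonneg ENNReal.toReal_nonneg]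
    exact ENNReal.toReal_le_of_le_ofReal zero_le_one (by simpa using prob_le_one)
  · exact .of_forall fun ω => ENNReal.toReal_nonneg

/-- Conditional expectations of random measures in terms of set integrals. -/
theorem isMeasureCondExp_iff (hm : m ≤ m₀) (hZ : Measurable Z) (hW : Measurable[m] W) :
    IsMeasureCondExp m P Z W ↔ ∀ A, MeasurableSet[m] A → ∀ B, MeasurableSet B →
      ∫⁻ ω in A, (Z ω : Measure S) B ∂P = ∫⁻ ω in A, (W ω : Measure S) B ∂P := by
  have hW' : Measurable W := hW.mono hm le_rfl
  have hint : ∀ {V : Ω → ProbabilityMeasure S}, Measurable V → ∀ {f : S → ℝ}, Measurable f →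
      ∀ {C : ℝ}, (∀ x, |f x| ≤ C) → Integrable (fun ω => ∫ x, f x ∂(V ω : Measure S)) P :=
    fun hV _ hf _ hC => .of_bound
      ((measurable_integral_probabilityMeasure hf).comp hV).aestronglyMeasurable _
      (.of_forall fun ω => abs_integral_probabilityMeasure_le _ hC)
  constructor
  · rintro ⟨-, h⟩ A hA B hB
    have hf : Measurable (B.indicator fun _ => (1 : ℝ)) := measurable_const.indicator hB
    have hC : ∀ x, |B.indicator (fun _ => (1 : ℝ)) x| ≤ 1 := fun x => by
      by_cases hx : x ∈ B <;> simp [hx]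
    rw [setLIntegral_measure_eq_ofReal hZ hB, setLIntegral_measure_eq_ofReal hW' hB,
      ← setIntegral_condExp hm (hint hZ hf hC) hA]
    congr 1
    exact integral_congr_ae (ae_restrict_of_ae (h _ hf ⟨1, hC⟩))
  · refine fun h => ⟨hW, fun f hf ⟨C, hC⟩ => ?_⟩
    refine (ae_eq_condExp_of_forall_setIntegral_eq hm (hint hZ hf hC)
      (fun _ _ _ => (hint hW' hf hC).integrableOn) (fun A hA _ => ?_) ?_).symm
    -- Equality of the set integrals for all `B` says that the mixtures of `Z` and of `W` over `A`
    -- are the same measure on `S`, so they integrate `f` equally.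
    · rw [integral_integral_eq_integral_bind hW' hf hC, integral_integral_eq_integral_bind hZ hf hC]
      congr 1
      ext B hB
      rw [Measure.bind_apply hB hW'.coe_probabilityMeasure.aemeasurable,
        Measure.bind_apply hB hZ.coe_probabilityMeasure.aemeasurable]
      exact (h A hA B hB).symm
    · exact ((measurable_integral_probabilityMeasure hf).comp hW).stronglyMeasurable
        |>.aestronglyMeasurable

end CondExp

section MartingaleLaws

variable {S : Type u} [TopologicalSpace S] [MeasurableSpace S] [BorelSpace S] [LusinSpace S]

theorem measurable_cadlagPath_apply (t : I) :
    Measurable fun z : CadlagPath (ProbabilityMeasure S) => z t :=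
  measurable_canonicalProcess S t

theorem measurable_canonicalProcess_filtration (t : I) :
    Measurable[canonicalFiltration S t] (canonicalProcess S t) :=
  measurable_iff_comap_le.2 (le_iSup₂_of_le
    (f := fun s (_ : s ≤ t) => MeasurableSpace.comap (canonicalProcess S s) _) t le_rfl le_rfl)

/-- This form involves only masses of sets, so it transports directly along embeddings of the state
space. -/
theorem mem_martingaleLaws_iff {μ : ProbabilityMeasure (CadlagPath (ProbabilityMeasure S))} :
    μ ∈ martingaleLaws S ↔ ∀ s t, s ≤ t → ∀ A, MeasurableSet[canonicalFiltration S s] A →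
      ∀ B, MeasurableSet B →
        ∫⁻ z in A, (z t : Measure S) B ∂(μ : Measure (CadlagPath (ProbabilityMeasure S))) =
          ∫⁻ z in A, (z s : Measure S) B ∂(μ : Measure (CadlagPath (ProbabilityMeasure S))) :=
  forall₃_congr fun s t _ => isMeasureCondExp_iff ((canonicalFiltration S).le s)
    (measurable_canonicalProcess S t) (measurable_canonicalProcess_filtration s)

theorem martingale_integral_of_mem_martingaleLaws
    {μ : ProbabilityMeasure (CadlagPath (ProbabilityMeasure S))} (hμ : μ ∈ martingaleLaws S)
    {f : S → ℝ} (hf : Measurable f) {C : ℝ} (hC : ∀ x, |f x| ≤ C) :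
    Martingale (fun (t : I) (z : CadlagPath (ProbabilityMeasure S)) => ∫ x, f x ∂(z t : Measure S))
      (canonicalFiltration S) (μ : Measure (CadlagPath (ProbabilityMeasure S))) :=
  ⟨fun t => ((measurable_integral_probabilityMeasure hf).comp
    (measurable_canonicalProcess_filtration t)).stronglyMeasurable,
    fun s t hst => (hμ s t hst).2 f hf ⟨C, hC⟩⟩

/-! ### Compact state spaces -/

/-- The evaluation of a probability measure at a test function. -/
noncomputable def testEval (S : Type*) [TopologicalSpace S] [CompactSpace S] [MetrizableSpace S]
    [MeasurableSpace S] [BorelSpace S] (k : ℕ) : C(ProbabilityMeasure S, I) where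
  toFun q := ⟨∫ x, (testFun S k x : ℝ) ∂(q : Measure S),
    integral_nonneg fun x => (testFun S k x).2.1,
    (le_abs_self _).trans (abs_integral_probabilityMeasure_le q fun _ => abs_testFunction_le _ _)⟩
  continuous_toFun := Continuous.subtype_mk (ProbabilityMeasure.continuous_integral_continuousMap
    (⟨fun x => (testFun S k x : ℝ), by fun_prop⟩ : C(S, ℝ))) _

theorem eq_of_forall_testEval [CompactSpace S] (p q : ProbabilityMeasure S)
    (h : ∀ k, testEval S k p = testEval S k q) : p = q :=
  ProbabilityMeasure.toMeasure_injective
    (Measure.ext_of_integral_testFun fun k => congrArg Subtype.val (h k))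

/-- Countably many continuous test functions suffice: they determine the mixtures of `z s` and `z t`
over any past event, and equality of these mixtures covers all Borel sets. -/
theorem martingaleLaws_eq_of_compact [CompactSpace S] :
    martingaleLaws S = {μ : ProbabilityMeasure (CadlagPath (ProbabilityMeasure S)) | ∀ k, IsCylinderMartingale
      (μ : Measure (CadlagPath (ProbabilityMeasure S))) (fun t z => z t) (testEval S k)} := by
  ext μ
  have htm : ∀ k, Measurable fun x => (testFun S k x : ℝ) := fun k =>
    (by fun_prop : Continuous fun x => (testFun S k x : ℝ)).measurable
  constructor
  · intro h k
    exact Martingale.isCylinderMartingale (martingale_integral_of_mem_martingaleLaws h (htm k)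
      fun x => abs_testFunction_le _ _) measurable_canonicalProcess_filtration
  · intro h
    refine mem_martingaleLaws_iff.2 fun s t hst A hA B hB => ?_
    have hA' := (canonicalFiltration S).le s A hA
    have hbind : ((μ : Measure (CadlagPath (ProbabilityMeasure S))).restrict A).bind
        (fun z => (z t : Measure S)) =
        ((μ : Measure (CadlagPath (ProbabilityMeasure S))).restrict A).bind
        (fun z => (z s : Measure S)) := by
      have hfin : ∀ r : I, IsFiniteMeasure
          (((μ : Measure (CadlagPath (ProbabilityMeasure S))).restrict A).bind
            fun z => (z r : Measure S)) := fun r => ⟨by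
        rw [Measure.bind_apply MeasurableSet.univ
          (measurable_cadlagPath_apply r).coe_probabilityMeasure.aemeasurable]
        simp⟩
      have := hfin s
      have := hfin t
      refine Measure.ext_of_integral_testFun fun k => ?_
      rw [← integral_integral_eq_integral_bind (measurable_cadlagPath_apply t) (htm k)
          (fun x => abs_testFunction_le _ _),
        ← integral_integral_eq_integral_bind (measurable_cadlagPath_apply s) (htm k)
          (fun x => abs_testFunction_le _ _)]
      have hM := (h k).martingale (measurable_canonicalProcess S)
      exact (hM.setIntegral_eq hst hA).symm
    have := congrArg (fun ρ : Measure S => ρ B) hbind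
    rwa [Measure.bind_apply hB (measurable_cadlagPath_apply t).coe_probabilityMeasure.aemeasurable,
      Measure.bind_apply hB (measurable_cadlagPath_apply s).coe_probabilityMeasure.aemeasurable]
      at this

theorem isCompact_martingaleLaws_of_compact [CompactSpace S] : IsCompact (martingaleLaws S) := by
  rw [martingaleLaws_eq_of_compact]
  exact isCompact_cylinderMartingaleLaws eq_of_forall_testEval

end MartingaleLaws

section TerminalIntensity

variable {S : Type u} [TopologicalSpace S] [MeasurableSpace S] [BorelSpace S] [LusinSpace S]

/-! ### The terminal intensity -/

theorem terminalIntensity_coe (μ : ProbabilityMeasure (CadlagPath (ProbabilityMeasure S))) :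
    (terminalIntensity μ : Measure S) =
      (μ : Measure (CadlagPath (ProbabilityMeasure S))).bind fun z => (z 1 : Measure S) := by
  ext B hB
  rw [Measure.bind_apply hB (measurable_cadlagPath_apply 1).coe_probabilityMeasure.aemeasurable]
  have h1 : (terminalIntensity μ : Measure S) B =
      ∫⁻ q, (q : Measure S) B ∂((μ.map (measurable_canonicalProcess S 1).aemeasurable :
        ProbabilityMeasure (ProbabilityMeasure S)) : Measure (ProbabilityMeasure S)) :=
    Measure.bind_apply hB measurable_subtype_coe.aemeasurable
  rw [h1]
  exact lintegral_map (measurable_probabilityMeasure_apply hB) (measurable_canonicalProcess S 1)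

theorem terminalIntensity_apply (μ : ProbabilityMeasure (CadlagPath (ProbabilityMeasure S)))
    {B : Set S} (hB : MeasurableSet B) : (terminalIntensity μ : Measure S) B =
      ∫⁻ z, (z 1 : Measure S) B ∂(μ : Measure (CadlagPath (ProbabilityMeasure S))) := by
  rw [terminalIntensity_coe,
    Measure.bind_apply hB (measurable_cadlagPath_apply 1).coe_probabilityMeasure.aemeasurable]

/-- Integrating `f` against the intensity amounts to integrating a bounded continuous function of
the terminal value, and evaluation at time 1 is continuous. -/
theorem continuous_terminalIntensity : Continuous (terminalIntensity (S := S)) := by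
  refine ProbabilityMeasure.continuous_iff_forall_continuous_integral.2 fun f => ?_
  have hC : ∀ x, |f x| ≤ ‖f‖ := f.norm_coe_le_norm
  let g : BoundedContinuousFunction (CadlagPath (ProbabilityMeasure S)) ℝ :=
    .ofNormedAddCommGroup (fun z => ∫ x, f x ∂(z 1 : Measure S))
      ((ProbabilityMeasure.continuous_integral_boundedContinuousFunction f).comp
        CadlagPath.continuous_eval_one) ‖f‖
      fun z => abs_integral_probabilityMeasure_le _ hC
  have h : ∀ μ : ProbabilityMeasure (CadlagPath (ProbabilityMeasure S)),
      ∫ x, f x ∂(terminalIntensity μ : Measure S) =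
        ∫ z, g z ∂(μ : Measure (CadlagPath (ProbabilityMeasure S))) := fun μ => by
    rw [terminalIntensity_coe]
    exact (integral_integral_eq_integral_bind (measurable_cadlagPath_apply 1)
      f.continuous.measurable hC).symm
  simp_rw [h]
  exact ProbabilityMeasure.continuous_integral_boundedContinuousFunction g

/-- Doob's maximal inequality for measure-valued martingales. -/
theorem mul_measure_exists_dyadicTime_lt_le_terminalIntensity
    {μ : ProbabilityMeasure (CadlagPath (ProbabilityMeasure S))} (hμ : μ ∈ martingaleLaws S)
    {U : Set S} (hU : MeasurableSet U) (ε : NNReal) :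
    ε * (μ : Measure (CadlagPath (ProbabilityMeasure S)))
      {z | ∃ d : DyadicTime, (ε : ℝ≥0∞) < (z d : Measure S) U} ≤
      (terminalIntensity μ : Measure S) U := by
  set P := (μ : Measure (CadlagPath (ProbabilityMeasure S)))
  let M : I → CadlagPath (ProbabilityMeasure S) → ℝ := fun t z =>
    ∫ x, U.indicator (fun _ => (1 : ℝ)) x ∂(z t : Measure S)
  have hMeq : ∀ t z, M t z = ((z t : Measure S) U).toReal := fun t z => by
    change ∫ x, U.indicator (fun _ => (1 : ℝ)) x ∂(z t : Measure S) = _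
    rw [integral_indicator_const _ hU, smul_eq_mul, mul_one]
    rfl
  have hM : Martingale M (canonicalFiltration S) P :=
    martingale_integral_of_mem_martingaleLaws hμ (measurable_const.indicator hU) (C := 1)
      fun x => by by_cases hx : x ∈ U <;> simp [hx]
  let A : ℕ → Set (CadlagPath (ProbabilityMeasure S)) := fun n =>
    {z | ∃ k ≤ 2 ^ n, (ε : ℝ≥0∞) < (z (dyadicTime n k) : Measure S) U}
  have hA : ∀ n, ε * P (A n) ≤ (terminalIntensity μ : Measure S) U := by
    intro n
    have hmono : Monotone fun k => (dyadicTime n k : I) := fun i j h => dyadicTime_mono n h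
    have hmax := maximal_ineq (hM.alongSeq hmono).submartingale
      (fun k z => by
        change 0 ≤ M _ z
        rw [hMeq]
        exact ENNReal.toReal_nonneg) (ε := ε) (2 ^ n)
    refine (mul_le_mul_right (measure_mono ?_) _).trans (hmax.trans ?_)
    · rintro z ⟨k, hk, hz⟩
      refine le_trans ?_ (Finset.le_sup' (fun k => M (dyadicTime n k) z)
        (Finset.mem_range.2 (Nat.lt_succ_of_le hk)))
      rw [hMeq]
      exact (ENNReal.ofReal_le_iff_le_toReal (measure_ne_top _ _)).1
        (by rw [ENNReal.ofReal_coe_nnreal]; exact hz.le)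
    · rw [dyadicTime_of_le le_rfl, terminalIntensity_apply μ hU,
        ← setLIntegral_univ, setLIntegral_measure_eq_ofReal (measurable_cadlagPath_apply 1) hU,
        setIntegral_univ]
      exact ENNReal.ofReal_le_ofReal (setIntegral_le_integral (hM.integrable 1)
        (.of_forall fun z => by
          change 0 ≤ M 1 z
          rw [hMeq]
          exact ENNReal.toReal_nonneg))
  -- A dyadic time belongs to all grids from some level on. The tail intersections increase with
  -- `n`, so continuity from below applies to their union.
  have hsub : {z : CadlagPath (ProbabilityMeasure S) |
      ∃ d : DyadicTime, (ε : ℝ≥0∞) < (z d : Measure S) U} ⊆ ⋃ n, ⋂ m ≥ n, A m := by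
    rintro z ⟨d, hd⟩
    obtain ⟨n, hn⟩ := eventually_atTop.1 d.eventually_eq
    refine mem_iUnion.2 ⟨n, mem_iInter₂.2 fun m hm => ?_⟩
    obtain ⟨k, hk, hkd⟩ := hn m hm
    exact ⟨k, hk, by rwa [hkd]⟩
  refine (mul_le_mul_right (measure_mono hsub) _).trans ?_
  have hmono : Monotone fun n => ⋂ m ≥ n, A m := fun i j h =>
    biInter_mono (fun m (hm : m ≥ j) => h.trans hm) fun _ _ => le_rfl
  rw [hmono.measure_iUnion, ENNReal.mul_iSup]
  exact iSup_le fun n => (mul_le_mul_right (measure_mono (biInter_subset_of_mem le_rfl)) _).trans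
    (hA n)

end TerminalIntensity

/-! ### Embeddings of the state space -/

section Embedding

variable {S : Type u} [TopologicalSpace S] [MeasurableSpace S] [BorelSpace S]
  {Y : Type*} [TopologicalSpace Y] [MeasurableSpace Y] [BorelSpace Y] {ι : S → Y}

/-- Both σ-algebras are generated by evaluations at measurable sets, and every measurable set of `S`
is the preimage of one of `Y`. -/
theorem comap_push (hι : IsEmbedding ι) :
    MeasurableSpace.comap (ProbabilityMeasure.push hι.continuous)
      (inferInstance : MeasurableSpace (ProbabilityMeasure Y)) =
      (inferInstance : MeasurableSpace (ProbabilityMeasure S)) := by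
  refine le_antisymm (measurable_iff_comap_le.1 (Measurable.subtype_mk
    ((Measure.measurable_map ι hι.continuous.measurable).comp measurable_subtype_coe))) ?_
  refine measurable_iff_comap_le.1 (@Measure.measurable_of_measurable_coe _ _ _
    (MeasurableSpace.comap (ProbabilityMeasure.push hι.continuous) inferInstance) _ fun B hB => ?_)
  have hS : MeasurableSpace.comap ι ‹MeasurableSpace Y› = ‹MeasurableSpace S› := by
    rw [‹BorelSpace S›.measurable_eq, ‹BorelSpace Y›.measurable_eq, hι.eq_induced, borel_comap]
  rw [← hS] at hB
  obtain ⟨C, hC, rfl⟩ := hB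
  have := (measurable_probabilityMeasure_apply hC).comp
    (comap_measurable (ProbabilityMeasure.push hι.continuous))
  simp only [Function.comp_def, ProbabilityMeasure.push_apply _ _ hC] at this
  exact this

variable [LusinSpace S] [LusinSpace Y]

/-- The map of measure-valued paths that is induced by an embedding of the state space. -/
noncomputable def pathPush (hι : IsEmbedding ι) :
    CadlagPath (ProbabilityMeasure S) → CadlagPath (ProbabilityMeasure Y) :=
  CadlagPath.map (ProbabilityMeasure.continuous_push hι.continuous)

theorem isEmbedding_pathPush (hι : IsEmbedding ι) : IsEmbedding (pathPush hι) :=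
  CadlagPath.isEmbedding_map (ProbabilityMeasure.isEmbedding_push hι)

theorem comap_pathPush (hι : IsEmbedding ι) :
    MeasurableSpace.comap (pathPush hι)
      (inferInstance : MeasurableSpace (CadlagPath (ProbabilityMeasure Y))) =
      (inferInstance : MeasurableSpace (CadlagPath (ProbabilityMeasure S))) := by
  rw [BorelSpace.measurable_eq (α := CadlagPath (ProbabilityMeasure S)),
    BorelSpace.measurable_eq (α := CadlagPath (ProbabilityMeasure Y)),
    (isEmbedding_pathPush hι).eq_induced, borel_comap]

/-- Pasts correspond exactly under the embedding, so the martingale property transfers in both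
directions. -/
theorem comap_pathPush_canonicalFiltration (hι : IsEmbedding ι) (s : I) :
    MeasurableSpace.comap (pathPush hι) (canonicalFiltration Y s) = canonicalFiltration S s := by
  change MeasurableSpace.comap (pathPush hι)
    (⨆ r ≤ s, MeasurableSpace.comap (canonicalProcess Y r) inferInstance) =
    ⨆ r ≤ s, MeasurableSpace.comap (canonicalProcess S r) inferInstance
  simp_rw [MeasurableSpace.comap_iSup, MeasurableSpace.comap_comp]
  refine iSup_congr fun r => iSup_congr fun _ => ?_
  rw [← comap_push hι, MeasurableSpace.comap_comp]
  rfl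

/-- The map of laws that is induced by an embedding of the state space. -/
noncomputable def lawPush (hι : IsEmbedding ι) :
    ProbabilityMeasure (CadlagPath (ProbabilityMeasure S)) →
      ProbabilityMeasure (CadlagPath (ProbabilityMeasure Y)) :=
  ProbabilityMeasure.push (isEmbedding_pathPush hι).continuous

theorem isEmbedding_lawPush [CompactSpace Y] (hι : IsEmbedding ι) : IsEmbedding (lawPush hι) :=
  ProbabilityMeasure.isEmbedding_push (isEmbedding_pathPush hι)

theorem setLIntegral_lawPush (hι : IsEmbedding ι)
    (μ : ProbabilityMeasure (CadlagPath (ProbabilityMeasure S)))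
    {A : Set (CadlagPath (ProbabilityMeasure Y))} (hA : MeasurableSet A) {B : Set Y}
    (hB : MeasurableSet B) (t : I) :
    ∫⁻ z in A, (z t : Measure Y) B ∂(lawPush hι μ : Measure (CadlagPath (ProbabilityMeasure Y))) =
      ∫⁻ z in pathPush hι ⁻¹' A, (z t : Measure S) (ι ⁻¹' B)
        ∂(μ : Measure (CadlagPath (ProbabilityMeasure S))) := by
  refine (setLIntegral_map hA ((measurable_probabilityMeasure_apply hB).comp
    (measurable_cadlagPath_apply t)) (isEmbedding_pathPush hι).continuous.measurable).trans ?_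
  exact lintegral_congr fun z => ProbabilityMeasure.push_apply hι.continuous _ hB

theorem lawPush_mem_martingaleLaws_iff (hι : IsEmbedding ι)
    {μ : ProbabilityMeasure (CadlagPath (ProbabilityMeasure S))} :
    lawPush hι μ ∈ martingaleLaws Y ↔ μ ∈ martingaleLaws S := by
  rw [mem_martingaleLaws_iff, mem_martingaleLaws_iff]
  refine forall₃_congr fun s t hst => ⟨fun h A hA B hB => ?_, fun h A hA B hB => ?_⟩
  · rw [← comap_pathPush_canonicalFiltration hι] at hA
    obtain ⟨A, hA, rfl⟩ := hA
    have hS : MeasurableSpace.comap ι ‹MeasurableSpace Y› = ‹MeasurableSpace S› := by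
      rw [‹BorelSpace S›.measurable_eq, ‹BorelSpace Y›.measurable_eq, hι.eq_induced, borel_comap]
    rw [← hS] at hB
    obtain ⟨B, hB, rfl⟩ := hB
    have hA' := (canonicalFiltration Y).le s A hA
    rw [← setLIntegral_lawPush hι μ hA' hB, ← setLIntegral_lawPush hι μ hA' hB]
    exact h A hA B hB
  · have hA' := (canonicalFiltration Y).le s A hA
    rw [setLIntegral_lawPush hι μ hA' hB, setLIntegral_lawPush hι μ hA' hB]
    refine h _ ?_ _ (hι.continuous.measurable hB)
    rw [← comap_pathPush_canonicalFiltration hι]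
    exact ⟨A, hA, rfl⟩

theorem terminalIntensity_lawPush (hι : IsEmbedding ι)
    (μ : ProbabilityMeasure (CadlagPath (ProbabilityMeasure S))) :
    terminalIntensity (lawPush hι μ) = (terminalIntensity μ).push hι.continuous := by
  refine ProbabilityMeasure.toMeasure_injective (Measure.ext fun B hB => ?_)
  rw [terminalIntensity_apply _ hB, ProbabilityMeasure.push_apply _ _ hB,
    terminalIntensity_apply _ (hι.continuous.measurable hB), ← setLIntegral_univ,
    setLIntegral_lawPush hι μ .univ hB, preimage_univ, setLIntegral_univ]

end Embedding

theorem ENNReal.eq_zero_of_forall_le_inv_natCast_add_one {a : ℝ≥0∞}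
    (h : ∀ n : ℕ, a ≤ ((n : ℝ≥0∞) + 1)⁻¹) : a = 0 := by
  refine le_antisymm (ge_of_tendsto' (x := atTop) (f := fun n : ℕ => ((n : ℝ≥0∞) + 1)⁻¹) ?_ h)
    zero_le
  exact_mod_cast (tendsto_add_atTop_iff_nat 1).2 ENNReal.tendsto_inv_nat_nhds_zero

/-! ### Lifting martingale laws from the compact ambient space -/

section Lift

variable {S : Type u} [TopologicalSpace S] [MeasurableSpace S] [BorelSpace S] [LusinSpace S]
  {Y : Type*} [TopologicalSpace Y] [MeasurableSpace Y] [BorelSpace Y] [LusinSpace Y] {ι : S → Y}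

/-- A path whose values at dyadic times are uniformly concentrated on the complements of a sequence
of open sets comes from a path in the smaller state space. -/
theorem mem_range_pathPush (hι : IsEmbedding ι) {U : ℕ → Set Y}
    (hU : ∀ n, IsOpen (U n)) (hιU : ∀ n, (range ι)ᶜ ⊆ U n)
    {z : CadlagPath (ProbabilityMeasure Y)}
    (hz : ∀ j : ℕ, ∃ n, ∀ d : DyadicTime, (z d : Measure Y) (U n) ≤ ((j : ℝ≥0∞) + 1)⁻¹) :
    z ∈ range (pathPush hι) := by
  let _ := metrizableSpaceMetric Y
  have hS : MeasurableSpace.comap ι ‹MeasurableSpace Y› = ‹MeasurableSpace S› := by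
    rw [‹BorelSpace S›.measurable_eq, ‹BorelSpace Y›.measurable_eq, hι.eq_induced, borel_comap]
  -- The mass of an open set is lower semicontinuous, so the bound passes from dyadic times to all
  -- times, and below to left limits.
  have hzt : ∀ j : ℕ, ∃ n, ∀ t : I, (z t : Measure Y) (U n) ≤ ((j : ℝ≥0∞) + 1)⁻¹ := fun j => by
    obtain ⟨n, hn⟩ := hz j
    refine ⟨n, fun t => ?_⟩
    refine (ProbabilityMeasure.le_liminf_measure_open_of_tendsto (z.tendsto_nextDyadic t)
      (hU n)).trans ?_
    exact liminf_le_of_le (by isBoundedDefault) fun b hb => hb.exists.elim fun k hk => hk.trans (hn _)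
  have hrange : ∀ q : ProbabilityMeasure Y,
      (∀ j : ℕ, ∃ n, (q : Measure Y) (U n) ≤ ((j : ℝ≥0∞) + 1)⁻¹) →
      ∃ p : ProbabilityMeasure S, p.push hι.continuous = q := fun q hq => by
    obtain ⟨p, hp⟩ := ProbabilityMeasure.exists_map_eq hι.injective hS q Subset.rfl (by
      refine ENNReal.eq_zero_of_forall_le_inv_natCast_add_one fun j => ?_
      obtain ⟨n, hn⟩ := hq j
      exact (measure_mono (hιU n)).trans hn)
    exact ⟨p, Subtype.ext hp⟩
  choose p hp using fun t => hrange (z t) fun j => (hzt j).imp fun n hn => hn t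
  have hind := (ProbabilityMeasure.isEmbedding_push hι).isInducing
  refine ⟨⟨p, fun t => ?_, fun t => ?_⟩, CadlagPath.ext fun t => hp t⟩
  · refine hind.tendsto_nhds_iff.2 ?_
    rw [Function.comp_def]
    simp_rw [hp]
    exact z.rightCont t
  -- With no times to the left, any value serves as left limit.
  · rcases (𝓝[<] t).eq_or_neBot with hbot | hne
    · exact ⟨p t, by rw [hbot]; exact tendsto_bot⟩
    · obtain ⟨l, hl⟩ := z.leftLim t
      obtain ⟨q, hq⟩ := hrange l fun j => by
        obtain ⟨n, hn⟩ := hzt j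
        refine ⟨n, (ProbabilityMeasure.le_liminf_measure_open_of_tendsto hl (hU n)).trans ?_⟩
        exact liminf_le_of_le (by isBoundedDefault) fun b hb =>
          hb.exists.elim fun k hk => hk.trans (hn _)
      refine ⟨q, hind.tendsto_nhds_iff.2 ?_⟩
      rw [Function.comp_def, hq]
      simp_rw [hp]
      exact hl

variable [CompactSpace Y]

/-- A martingale law whose terminal intensity is concentrated on `S` comes from a martingale law
with state space `S`. -/
theorem mem_range_lawPush (hι : IsEmbedding ι) (hm : MeasurableSet (range ι))
    {μ : ProbabilityMeasure (CadlagPath (ProbabilityMeasure Y))} (hμ : μ ∈ martingaleLaws Y)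
    (h : (terminalIntensity μ : Measure Y) (range ι)ᶜ = 0) : μ ∈ range (lawPush hι) := by
  let _ := metrizableSpaceMetric Y
  -- Inner regularity of the terminal intensity, which is concentrated on the Borel set `range ι`.
  have hK : ∀ n : ℕ, ∃ K ⊆ range ι, IsClosed K ∧
      (terminalIntensity μ : Measure Y) Kᶜ ≤ ((n : ℝ≥0∞) + 1)⁻¹ := fun n => by
    obtain ⟨K, hK, -, hKc, hKn⟩ := hm.exists_isCompact_isClosed_sdiff_lt
      (measure_ne_top (terminalIntensity μ : Measure Y) _)
      (ε := ((n : ℝ≥0∞) + 1)⁻¹) (by simp)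
    refine ⟨K, hK, hKc, ?_⟩
    have hsub : Kᶜ ⊆ range ι \ K ∪ (range ι)ᶜ := fun x hx => by
      by_cases hxι : x ∈ range ι
      · exact .inl ⟨hxι, hx⟩
      · exact .inr hxι
    refine (measure_mono hsub).trans ((measure_union_le _ _).trans ?_)
    rw [h, add_zero]
    exact hKn.le
  choose K hKι hKc hKn using hK
  let G : Set (CadlagPath (ProbabilityMeasure Y)) := {z | ∀ j : ℕ, ∃ n, ∀ d : DyadicTime,
    (z d : Measure Y) (K n)ᶜ ≤ ((j : ℝ≥0∞) + 1)⁻¹}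
  have hG : G ⊆ range (pathPush hι) := fun z hz => mem_range_pathPush hι
    (fun n => (hKc n).isOpen_compl) (fun n => compl_subset_compl.2 (hKι n)) hz
  have hμG : (μ : Measure (CadlagPath (ProbabilityMeasure Y))) Gᶜ = 0 := by
    have hsub : Gᶜ ⊆ ⋃ j : ℕ, {z | ∀ n, ∃ d : DyadicTime,
        ((j : ℝ≥0∞) + 1)⁻¹ < (z d : Measure Y) (K n)ᶜ} := fun z hz => by
      have hz' : ¬ ∀ j : ℕ, ∃ n, ∀ d : DyadicTime,
        (z d : Measure Y) (K n)ᶜ ≤ ((j : ℝ≥0∞) + 1)⁻¹ := hz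
      push Not at hz'
      exact mem_iUnion.2 hz'
    refine measure_mono_null hsub (measure_iUnion_null fun j => ?_)
    let ε : NNReal := ((j : NNReal) + 1)⁻¹
    have hε : (ε : ℝ≥0∞) = ((j : ℝ≥0∞) + 1)⁻¹ := by
      rw [ENNReal.coe_inv (by positivity)]
      push_cast
      rfl
    have hε0 : (ε : ℝ≥0∞) ≠ 0 := by rw [hε]; simp
    refine (mul_eq_zero.1 (ENNReal.eq_zero_of_forall_le_inv_natCast_add_one
      fun n => ?_)).resolve_left hε0
    -- By the maximal inequality the probability of exceeding `ε` outside `K n` is at most the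
    -- intensity there divided by `ε`. The bad event lies in all of these, so it is null.
    refine (mul_le_mul_right (measure_mono fun z hz => ?_) _).trans
      ((mul_measure_exists_dyadicTime_lt_le_terminalIntensity hμ
        (hKc n).isOpen_compl.measurableSet ε).trans (hKn n))
    rw [hε]
    exact hz n
  -- Measurability of the range of `pathPush hι` is not needed: it contains the conull set `G`.
  obtain ⟨ν, hν⟩ := ProbabilityMeasure.exists_map_eq (isEmbedding_pathPush hι).injective
    (comap_pathPush hι) μ hG hμG
  exact ⟨ν, Subtype.ext hν⟩

theorem mem_lawPush_image_martingaleLaws_iff (hι : IsEmbedding ι) (hm : MeasurableSet (range ι))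
    {μ : ProbabilityMeasure (CadlagPath (ProbabilityMeasure Y))} (hμ : μ ∈ martingaleLaws Y) :
    μ ∈ lawPush hι '' martingaleLaws S ↔
      (terminalIntensity μ : Measure Y) (range ι)ᶜ = 0 := by
  constructor
  · rintro ⟨ν, -, rfl⟩
    rw [terminalIntensity_lawPush, ProbabilityMeasure.push_apply _ _ hm.compl]
    simp
  · intro h
    obtain ⟨ν, rfl⟩ := mem_range_lawPush hι hm hμ h
    exact ⟨ν, (lawPush_mem_martingaleLaws_iff hι).1 hμ, rfl⟩

/-- The map `M(S) → M(Y)` that is induced by an embedding `S → Y`. -/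
noncomputable def martingaleLawPush (hι : IsEmbedding ι) (μ : martingaleLaws S) :
    martingaleLaws Y :=
  ⟨lawPush hι μ, (lawPush_mem_martingaleLaws_iff hι).2 μ.2⟩

theorem isEmbedding_martingaleLawPush (hι : IsEmbedding ι) :
    IsEmbedding (martingaleLawPush hι) := by
  have h : IsEmbedding fun μ : martingaleLaws S => lawPush hι μ :=
    (isEmbedding_lawPush hι).comp .subtypeVal
  exact .of_comp (h.continuous.subtype_mk _) continuous_subtype_val h

/-- This describes M(S) inside M(Y) by a condition on the terminal intensity alone, from which its
Borel or G_δ character can be read off. -/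
theorem range_martingaleLawPush (hι : IsEmbedding ι) (hm : MeasurableSet (range ι)) :
    range (martingaleLawPush hι) = {μ : martingaleLaws Y |
      (terminalIntensity (μ : ProbabilityMeasure (CadlagPath (ProbabilityMeasure Y))) :
        Measure Y) (range ι)ᶜ = 0} := by
  ext μ
  rw [mem_ofPred_eq, ← mem_lawPush_image_martingaleLaws_iff hι hm μ.2]
  constructor
  · rintro ⟨ν, rfl⟩
    exact ⟨ν, ν.2, rfl⟩
  · rintro ⟨ν, hν, h⟩
    exact ⟨⟨ν, hν⟩, Subtype.ext h⟩

/-- The martingale laws with terminal intensity in a compact set form a compact set. -/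
theorem isCompact_martingaleLaws_inter_preimage (hι : IsEmbedding ι) (hm : MeasurableSet (range ι))
    {K : Set (ProbabilityMeasure S)} (hK : IsCompact K) :
    IsCompact (martingaleLaws S ∩ terminalIntensity ⁻¹' K) := by
  rw [(isEmbedding_lawPush hι).isInducing.isCompact_iff]
  -- Measures pushed forward from `S` do not charge the complement of `range ι`, so the lifting
  -- criterion applies. The image becomes a closed condition on the compact space M(Y).
  have himage : lawPush hι '' (martingaleLaws S ∩ terminalIntensity ⁻¹' K) =
      martingaleLaws Y ∩ terminalIntensity ⁻¹' (ProbabilityMeasure.push hι.continuous '' K) := by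
    ext μ
    constructor
    · rintro ⟨ν, ⟨hν, hνK⟩, rfl⟩
      exact ⟨(lawPush_mem_martingaleLaws_iff hι).2 hν, _, hνK,
        (terminalIntensity_lawPush hι ν).symm⟩
    · rintro ⟨hμ, q, hq, hqμ⟩
      obtain ⟨ν, hν, rfl⟩ := (mem_lawPush_image_martingaleLaws_iff hι hm hμ).2 (by
        rw [← hqμ, ProbabilityMeasure.push_apply _ _ hm.compl]
        simp)
      refine ⟨ν, ⟨hν, ?_⟩, rfl⟩
      rw [terminalIntensity_lawPush] at hqμ
      rwa [mem_preimage, ← (ProbabilityMeasure.isEmbedding_push hι).injective hqμ]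
  rw [himage]
  exact isCompact_martingaleLaws_of_compact.inter_right
    ((hK.image (ProbabilityMeasure.continuous_push hι.continuous)).isClosed.preimage
      continuous_terminalIntensity)

end Lift

/-! ### Relative compactness and the topological type of M(S) -/

section Main

variable {S : Type u} [TopologicalSpace S] [MeasurableSpace S] [BorelSpace S] [LusinSpace S]

theorem polishSpace_of_compactSpace (X : Type*) [TopologicalSpace X] [CompactSpace X]
    [MetrizableSpace X] : PolishSpace X := by
  let _ := metrizableSpaceMetric X
  infer_instance

theorem isCompact_closure_iff_of_subset_martingaleLaws
    {A : Set (ProbabilityMeasure (CadlagPath (ProbabilityMeasure S)))} (hA : A ⊆ martingaleLaws S) :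
    IsCompact (closure A) ↔ IsCompact (closure (terminalIntensity '' A)) := by
  constructor
  · intro h
    exact (h.image continuous_terminalIntensity).closure_of_subset (image_mono subset_closure)
  · intro h
    obtain ⟨ι, hι, hm⟩ := LusinSpace.exists_embedding_hilbertCube S
    exact (isCompact_martingaleLaws_inter_preimage hι hm h).closure_of_subset fun μ hμ =>
      ⟨hA hμ, subset_closure (mem_image_of_mem _ hμ)⟩

theorem lusinSpace_martingaleLaws : LusinSpace (martingaleLaws S) := by
  obtain ⟨ι, hι, hm⟩ := LusinSpace.exists_embedding_hilbertCube S
  have := isCompact_iff_compactSpace.1 (isCompact_martingaleLaws_of_compact (S := ℕ → I))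
  have := polishSpace_of_compactSpace (martingaleLaws (ℕ → I))
  -- The ambient Polish space must live in the universe of `S`.
  let e : ULift.{u} (martingaleLaws (ℕ → I)) ≃ₜ martingaleLaws (ℕ → I) := Homeomorph.ulift
  refine ⟨ULift.{u} (martingaleLaws (ℕ → I)), inferInstance, e.isClosedEmbedding.polishSpace,
    e.symm ∘ martingaleLawPush hι, e.symm.isEmbedding.comp (isEmbedding_martingaleLawPush hι), ?_⟩
  let f : ULift.{u} (martingaleLaws (ℕ → I)) → ProbabilityMeasure (ℕ → I) := fun μ =>
    terminalIntensity (e μ : ProbabilityMeasure (CadlagPath (ProbabilityMeasure (ℕ → I))))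
  have hf : Continuous f :=
    continuous_terminalIntensity.comp (continuous_subtype_val.comp e.continuous)
  have hrange : range (e.symm ∘ martingaleLawPush hι) =
      f ⁻¹' {q | (q : Measure (ℕ → I)) (range ι)ᶜ = 0} := by
    rw [range_comp, range_martingaleLawPush hι hm, e.symm.image_eq_preimage_symm]
    rfl
  rw [hrange]
  refine hf.borel_measurable ?_
  rw [← BorelSpace.measurable_eq]
  exact measurable_probabilityMeasure_apply hm.compl (measurableSet_singleton 0)

theorem isOpen_measure_lt_of_isClosed {Y : Type*} [TopologicalSpace Y] [MetrizableSpace Y]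
    [MeasurableSpace Y] [BorelSpace Y] {F : Set Y} (hF : IsClosed F) (c : ℝ≥0∞) :
    IsOpen {q : ProbabilityMeasure Y | (q : Measure Y) F < c} := by
  let _ := metrizableSpaceMetric Y
  refine isOpen_iff_eventually.2 fun q hq => eventually_lt_of_limsup_lt (b := c) ?_
  exact (ProbabilityMeasure.limsup_measure_closed_le_of_tendsto
    (tendsto_id (α := ProbabilityMeasure Y)) hF).trans_lt hq

/-- The image of `S` in the cube is a G_δ, and the mass of each closed complement is upper
semicontinuous. So vanishing of the intensity off `S` is a countable intersection of open
conditions, indexed by pairs of an open set and a threshold. -/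
theorem polishSpace_martingaleLaws [PolishSpace S] : PolishSpace (martingaleLaws S) := by
  obtain ⟨ι, hι, hm⟩ := LusinSpace.exists_embedding_hilbertCube S
  have := isCompact_iff_compactSpace.1 (isCompact_martingaleLaws_of_compact (S := ℕ → I))
  have := polishSpace_of_compactSpace (martingaleLaws (ℕ → I))
  obtain ⟨U, hU, hιU⟩ := hι.exists_range_eq_iInter
  let V : ℕ → Set (martingaleLaws (ℕ → I)) := fun i => {μ |
    (terminalIntensity (μ : ProbabilityMeasure (CadlagPath (ProbabilityMeasure (ℕ → I)))) :
      Measure (ℕ → I)) (U i.unpair.1)ᶜ < ((i.unpair.2 : ℝ≥0∞) + 1)⁻¹}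
  have hV : ∀ i, IsOpen (V i) := fun i =>
    (isOpen_measure_lt_of_isClosed (hU i.unpair.1).isClosed_compl _).preimage
      (continuous_terminalIntensity.comp continuous_subtype_val)
  have hrange : range (martingaleLawPush hι) = ⋂ i, V i := by
    rw [range_martingaleLawPush hι hm]
    ext μ
    rw [mem_ofPred_eq, hιU, compl_iInter, measure_iUnion_null_iff, mem_iInter]
    constructor
    · intro h i
      simp only [V, mem_ofPred_eq, h]
      simp
    · intro h n
      refine ENNReal.eq_zero_of_forall_le_inv_natCast_add_one fun k => ?_
      have := h (Nat.pair n k)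
      simp only [V, Nat.unpair_pair] at this
      exact this.le
  have hP : PolishSpace (range (martingaleLawPush hι)) := by
    rw [hrange]
    exact polishSpace_iInter_of_isOpen hV
  exact (isEmbedding_martingaleLawPush hι).toHomeomorph.isClosedEmbedding.polishSpace

end Main

theorem mainTheorem5 {S : Type*} [TopologicalSpace S] [MeasurableSpace S] [BorelSpace S]
    [LusinSpace S] :
    (∀ A : Set (ProbabilityMeasure (CadlagPath (ProbabilityMeasure S))), A ⊆ martingaleLaws S →
      (IsCompact (closure A) ↔ IsCompact (closure (terminalIntensity '' A)))) ∧
    LusinSpace (martingaleLaws S) ∧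
    (PolishSpace S → PolishSpace (martingaleLaws S)) ∧
    (CompactSpace S ∧ MetrizableSpace S →
      CompactSpace (martingaleLaws S) ∧ MetrizableSpace (martingaleLaws S)) := by
  refine ⟨fun A hA => isCompact_closure_iff_of_subset_martingaleLaws hA,
    lusinSpace_martingaleLaws, fun _ => polishSpace_martingaleLaws, fun ⟨_, _⟩ => ?_⟩
  have := lusinSpace_martingaleLaws (S := S)
  exact ⟨isCompact_iff_compactSpace.1 isCompact_martingaleLaws_of_compact, inferInstance⟩
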